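/- Let $n>k\ge 1$ be integers and $J=\{1,\dots,n\}$. Let $(b_j^m)_{j\in J,\,1\le m\le k}$ be complex numbers; for $i_1,\dots,i_k\in J$ put $d_{i_1,\dots,i_k}=\det_{\ell,m=1}^k(b^m_{i_\ell})$, and assume $d_{i_1,\dots,i_k}\neq 0$ whenever $i_1,\dots,i_k$ are distinct. Let $a_1,\dots,a_n\in\mathbb C^\times$ with $\sum_{j\in J}a_j\ne 0$. For $z\in\mathbb C^n$, $t\in\mathbb C^k$ put $f_j(z,t)=z_j+\sum_{m=1}^k b_j^m t_m$ and let $\Phi(z,t)=\sum_{j\in J}a_j\log f_j(z,t)$ (a multivalued function whose first partial derivatives are single-valued on the set where all $f_j\neq0$). For $i_1,\dots,i_{k+1}\in J$ put $$f_{i_1,\dots,i_{k+1}}(z)=\sum_{m=1}^{k+1}(-1)^{m-1}d_{i_1,\dots,\widehat{i_m},\dots,i_{k+1}}\,z_{i_m},$$ and let $\Delta\subset\mathbb C^n$ be the union of the hyperplanes $f_{i_1,\dots,i_{k+1}}(z)=0$ over all $i_1<\dots<i_{k+1}$. Let $$C_\Phi=\Big\{(z,t)\in(\mathbb C^n-\Delta)\times\mathbb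 C^k\ \Big|\ f_j(z,t)\ne0\ (j\in J),\ \ \frac{\partial\Phi}{\partial t_i}(z,t)=0\ (1\le i\le k)\Big\},$$ and let $\Lambda=\phi(C_\Phi)$, where $$\phi:C_\Phi\to(\mathbb C^n-\Delta)\times(\mathbb C^\times)^n,\qquad \phi(z,t)=\Big(z_1,\dots,z_n,\ p_1=\frac{\partial\Phi}{\partial z_1}(z,t),\dots,p_n=\frac{\partial\Phi}{\partial z_n}(z,t)\Big).$$ For every set $I=\{i_1,\dots,i_{k-1}\}$ of $k-1$ distinct elements of $J$ define (relation of first kind) $$F_I=\sum_{j\in J}d_{j,i_1,\dots,i_{k-1}}\,p_j,$$ and for every set $I=\{i_1,\dots,i_{k+1}\}$ of $k+1$ distinct elements of $J$ define (relation of second kind) $$F_I=p_{i_1}\cdots p_{i_{k+1}}\,f_{i_1,\dots,i_{k+1}}(z)+\sum_{m=1}^{k+1}(-1)^m a_{i_m}\,d_{i_1,\dots,\widehat{i_m},\dots,i_{k+1}}\,p_{i_1}\cdots\widehat{p_{i_m}}\cdots p_{i_{k+1}}$$ (up to sign, these do not depend on the order of the elements of $I$). Let $\mathcal O$ be the algebra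 of regular functions on $(\mathbb C^n-\Delta)\times(\mathbb C^\times)^n$. Then the ideal of all functions in $\mathcal O$ that equal zero on $\Lambda$ coincides with the ideal of $\mathcal O$ generated by all $F_I$ with $|I|=k-1$ and $|I|=k+1$. Moreover, $\Lambda$ is a nonempty smooth closed subvariety of $(\mathbb C^n-\Delta)\times(\mathbb C^\times)^n$, and it is Lagrangian for the symplectic form $\sum_{j=1}^n dp_j\wedge dz_j$: at every point of $\Lambda$ its tangent space is $n$-dimensional and isotropic. -/

import Mathlib

noncomputable section

namespace MasterLagrangian

open MvPolynomial

/-! Zariski open and locally closed subsets of an affine space `σ → ℂ` -/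

section AffineGeometry

variable {σ : Type}

/-- The algebra `𝒪(U)` of regular functions on a Zariski open subset `U` of the affine space
`σ → ℂ`: quotients of polynomials whose denominator has no zero on `U`. (Polynomial rings are
factorial, so being such a quotient locally on `U` is the same as being one globally.) -/
def regularFunctions (U : Set (σ → ℂ)) : Subalgebra ℂ (U → ℂ) where
  carrier := {g | ∃ P Q : MvPolynomial σ ℂ,
    ∀ x : U, eval x.1 Q ≠ 0 ∧ g x = eval x.1 P / eval x.1 Q}
  mul_mem' := by
    rintro g h ⟨P, Q, hg⟩ ⟨P', Q', hh⟩
    refine ⟨P * P', Q * Q', fun x => ⟨?_, ?_⟩⟩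
    · rw [map_mul]
      exact mul_ne_zero (hg x).1 (hh x).1
    · rw [Pi.mul_apply, (hg x).2, (hh x).2, map_mul, map_mul, div_mul_div_comm]
  add_mem' := by
    rintro g h ⟨P, Q, hg⟩ ⟨P', Q', hh⟩
    refine ⟨P * Q' + Q * P', Q * Q', fun x => ⟨?_, ?_⟩⟩
    · rw [map_mul]
      exact mul_ne_zero (hg x).1 (hh x).1
    · rw [Pi.add_apply, (hg x).2, (hh x).2, map_add, map_mul, map_mul, map_mul,
        div_add_div _ _ (hg x).1 (hh x).1]
  algebraMap_mem' := fun c => ⟨C c, 1, fun x => by simp⟩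

/-- A polynomial, considered as a regular function on `U`. -/
def polyOn (U : Set (σ → ℂ)) (P : MvPolynomial σ ℂ) : regularFunctions U :=
  ⟨fun x => eval x.1 P, P, 1, fun x => by simp⟩

/-- The ideal of all regular functions on `U` that equal zero on `Y`. -/
def vanishingIdealOn (U Y : Set (σ → ℂ)) : Ideal (regularFunctions U) where
  carrier := {g | ∀ x : U, x.1 ∈ Y → g.1 x = 0}
  zero_mem' := fun _ _ => rfl
  add_mem' := fun {g h} hg hh x hx => by
    change g.1 x + h.1 x = 0
    rw [hg x hx, hh x hx, add_zero]
  smul_mem' := fun g h hh x hx => by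
    change g.1 x * h.1 x = 0
    rw [hh x hx, mul_zero]

/-- `Y` is a Zariski closed subset of `U`. -/
def IsZariskiClosedIn (U Y : Set (σ → ℂ)) : Prop :=
  ∃ S : Set (MvPolynomial σ ℂ), Y = {x ∈ U | ∀ P ∈ S, eval x P = 0}

/-- The Zariski tangent space at `x` of a locally closed subset `Y` of affine space: the vectors
annihilated by the differentials at `x` of all polynomials vanishing on `Y`. -/
def tangentSpaceAt [Fintype σ] (Y : Set (σ → ℂ)) (x : σ → ℂ) : Submodule ℂ (σ → ℂ) where
  carrier := {v | ∀ P : MvPolynomial σ ℂ, (∀ y ∈ Y, eval y P = 0) →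
    ∑ s, eval x (pderiv s P) * v s = 0}
  zero_mem' := fun P _ => by simp
  add_mem' := fun {v w} hv hw P hP => by
    simp only [Pi.add_apply, mul_add, Finset.sum_add_distrib, hv P hP, hw P hP, add_zero]
  smul_mem' := fun c v hv P hP => by
    simp only [Pi.smul_apply, smul_eq_mul, mul_left_comm _ c, ← Finset.mul_sum, hv P hP, mul_zero]

end AffineGeometry

/-! The space `ℂⁿ × ℂⁿ`: the coordinate `z_j` of a point `x` is `x (Sum.inl j)` and the coordinate
`p_j` is `x (Sum.inr j)` -/

/-- The symplectic form `∑ⱼ dp_j ∧ dz_j`, evaluated on two tangent vectors. -/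
def symplecticForm {n : ℕ} (v w : Fin n ⊕ Fin n → ℂ) : ℂ :=
  ∑ j, (v (Sum.inr j) * w (Sum.inl j) - v (Sum.inl j) * w (Sum.inr j))

/-- `Y` is a (nonempty) smooth Lagrangian subvariety of the Zariski open set `U ⊆ ℂⁿ × ℂⁿ`: it is
Zariski closed in `U`, its coordinate ring is a smooth `ℂ`-algebra, and all its tangent spaces have
dimension `n` and are isotropic for `∑ⱼ dp_j ∧ dz_j`. -/
structure IsSmoothLagrangianIn {n : ℕ} (U Y : Set (Fin n ⊕ Fin n → ℂ)) : Prop where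
  nonempty : Y.Nonempty
  closed : IsZariskiClosedIn U Y
  smooth : Algebra.Smooth ℂ (regularFunctions U ⧸ vanishingIdealOn U Y)
  finrank_tangent : ∀ x ∈ Y, Module.finrank ℂ (tangentSpaceAt Y x) = n
  isotropic : ∀ x ∈ Y, ∀ v ∈ tangentSpaceAt Y x, ∀ w ∈ tangentSpaceAt Y x, symplecticForm v w = 0

/-! The arrangement. The entry `b j m` is the coefficient of `t_m` in the linear function `g_j`. -/

section Arrangement

variable {n k : ℕ}

/-- The number `d_{i_1,…,i_k}`. -/
def plucker (b : Matrix (Fin n) (Fin k) ℂ) (i : Fin k → Fin n) : ℂ :=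
  (b.submatrix i id).det

/-- The collection of linear functions `g_1, …, g_n` is generic. -/
def IsGeneric (b : Matrix (Fin n) (Fin k) ℂ) : Prop :=
  ∀ i : Fin k → Fin n, Function.Injective i → plucker b i ≠ 0

/-- The function `f_j(z,t) = z_j + g_j(t)`. -/
def f (b : Matrix (Fin n) (Fin k) ℂ) (j : Fin n) (z : Fin n → ℂ) (t : Fin k → ℂ) : ℂ :=
  z j + ∑ m, b j m * t m

/-- The linear form `f_{i_1,…,i_{k+1}}(z) = ∑ₘ (-1)^(m-1) d_{i_1,…,îₘ,…,i_{k+1}} z_{iₘ}` (here the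
index `m` starts from `0`), for `z` with entries in any commutative `ℂ`-algebra. -/
def discForm {R : Type} [CommRing R] [Algebra ℂ R] (b : Matrix (Fin n) (Fin k) ℂ)
    (i : Fin (k + 1) → Fin n) (z : Fin n → R) : R :=
  ∑ m : Fin (k + 1), ((-1) ^ (m : ℕ) * plucker b (fun l => i (m.succAbove l))) • z (i m)

/-- The discriminant `Δ ⊆ ℂⁿ`. -/
def discriminant (b : Matrix (Fin n) (Fin k) ℂ) : Set (Fin n → ℂ) :=
  {z | ∃ i : Fin (k + 1) → Fin n, StrictMono i ∧ discForm b i z = 0}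

/-- The partial derivative `∂Φ/∂t_i` of the multivalued master function `Φ = ∑ⱼ a_j log f_j`; it
does not depend on the branches of the logarithms. -/
def masterDerivT (a : Fin n → ℂ) (b : Matrix (Fin n) (Fin k) ℂ) (i : Fin k)
    (z : Fin n → ℂ) (t : Fin k → ℂ) : ℂ :=
  ∑ j, a j * logDeriv (fun s : ℂ => f b j z (Function.update t i s)) (t i)

/-- The partial derivative `∂Φ/∂z_i` of the multivalued master function `Φ = ∑ⱼ a_j log f_j`. -/
def masterDerivZ (a : Fin n → ℂ) (b : Matrix (Fin n) (Fin k) ℂ) (i : Fin n)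
    (z : Fin n → ℂ) (t : Fin k → ℂ) : ℂ :=
  ∑ j, a j * logDeriv (fun s : ℂ => f b j (Function.update z i s) t) (z i)

theorem masterDerivT_eq (a : Fin n → ℂ) (b : Matrix (Fin n) (Fin k) ℂ) (i : Fin k)
    (z : Fin n → ℂ) (t : Fin k → ℂ) :
    masterDerivT a b i z t = ∑ j, b j i * (a j / f b j z t) := by
  unfold masterDerivT
  refine Finset.sum_congr rfl fun j _ => ?_
  have h : HasDerivAt (fun s : ℂ => f b j z (Function.update t i s)) (b j i) (t i) := by
    have h1 : HasDerivAt (fun s : ℂ => ∑ m, b j m * Function.update t i s m)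
        (∑ m, b j m * (Pi.single i (1 : ℂ) : Fin k → ℂ) m) (t i) := by
      refine HasDerivAt.fun_sum fun m _ => HasDerivAt.const_mul _ ?_
      exact hasDerivAt_pi.1 (hasDerivAt_update t i (t i)) m
    have h2 : ∑ m, b j m * (Pi.single i (1 : ℂ) : Fin k → ℂ) m = b j i := by
      simp [Pi.single_apply]
    rw [h2] at h1
    exact h1.const_add (z j)
  rw [logDeriv_apply, h.deriv, Function.update_eq_self]
  ring

theorem masterDerivZ_eq (a : Fin n → ℂ) (b : Matrix (Fin n) (Fin k) ℂ) (i : Fin n)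
    (z : Fin n → ℂ) (t : Fin k → ℂ) :
    masterDerivZ a b i z t = a i / f b i z t := by
  unfold masterDerivZ
  have h : ∀ j, HasDerivAt (fun s : ℂ => f b j (Function.update z i s) t)
      ((Pi.single i (1 : ℂ) : Fin n → ℂ) j) (z i) := fun j =>
    (hasDerivAt_pi.1 (hasDerivAt_update z i (z i)) j).add_const _
  simp only [logDeriv_apply, (h _).deriv, Function.update_eq_self, Pi.single_apply]
  simp [div_eq_mul_inv]

/-- The critical set `C_Φ` of the master function with respect to the variables `t`, over
`z ∈ ℂⁿ - Δ`. -/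
def criticalSet (a : Fin n → ℂ) (b : Matrix (Fin n) (Fin k) ℂ) :
    Set ((Fin n → ℂ) × (Fin k → ℂ)) :=
  {q | q.1 ∉ discriminant b ∧ (∀ j, f b j q.1 q.2 ≠ 0) ∧ ∀ i, masterDerivT a b i q.1 q.2 = 0}

/-- The map `φ(z,t) = (z, ∂Φ/∂z(z,t))`. -/
def phi (a : Fin n → ℂ) (b : Matrix (Fin n) (Fin k) ℂ) (q : (Fin n → ℂ) × (Fin k → ℂ)) :
    Fin n ⊕ Fin n → ℂ :=
  Sum.elim q.1 (fun j => masterDerivZ a b j q.1 q.2)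

/-- The set `Λ = φ(C_Φ)`. -/
def lagrangianSet (a : Fin n → ℂ) (b : Matrix (Fin n) (Fin k) ℂ) : Set (Fin n ⊕ Fin n → ℂ) :=
  phi a b '' criticalSet a b

/-- The Zariski open set `(ℂⁿ - Δ) × (ℂˣ)ⁿ`. -/
def phaseSpace (b : Matrix (Fin n) (Fin k) ℂ) : Set (Fin n ⊕ Fin n → ℂ) :=
  {x | (fun j => x (Sum.inl j)) ∉ discriminant b ∧ ∀ j, x (Sum.inr j) ≠ 0}

/-- The sequence `j, i_1, …, i_{k-1}` of length `k`, for `k ≥ 1`. -/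
def consIndex (j : Fin n) (i : Fin (k - 1) → Fin n) : Fin k → Fin n :=
  fun l => if h : (l : ℕ) = 0 then j else i ⟨l - 1, by omega⟩

/-- The polynomial `F_I` of first kind, `I = {i_1, …, i_{k-1}}`. -/
def relFirst (b : Matrix (Fin n) (Fin k) ℂ) (i : Fin (k - 1) → Fin n) :
    MvPolynomial (Fin n ⊕ Fin n) ℂ :=
  ∑ j, C (plucker b (consIndex j i)) * X (Sum.inr j)

/-- The polynomial `F_I` of second kind, `I = {i_1, …, i_{k+1}}` (here the summation index `m`
starts from `0`). -/
def relSecond (a : Fin n → ℂ) (b : Matrix (Fin n) (Fin k) ℂ) (i : Fin (k + 1) → Fin n) :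
    MvPolynomial (Fin n ⊕ Fin n) ℂ :=
  (∏ m, X (Sum.inr (i m))) * discForm b i (fun j => X (Sum.inl j)) +
    ∑ m : Fin (k + 1), C ((-1) ^ ((m : ℕ) + 1) * a (i m) * plucker b (fun l => i (m.succAbove l))) *
      ∏ l : Fin k, X (Sum.inr (i (m.succAbove l)))

/-- The ideal of `𝒪((ℂⁿ - Δ) × (ℂˣ)ⁿ)` generated by all relations of first and second kind. -/
def relationIdeal (a : Fin n → ℂ) (b : Matrix (Fin n) (Fin k) ℂ) :
    Ideal (regularFunctions (phaseSpace b)) :=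
  Ideal.span
    ({g | ∃ i : Fin (k - 1) → Fin n, Function.Injective i ∧
        g = polyOn (phaseSpace b) (relFirst b i)} ∪
     {g | ∃ i : Fin (k + 1) → Fin n, Function.Injective i ∧
        g = polyOn (phaseSpace b) (relSecond a b i)})

end Arrangement

end MasterLagrangian

end

noncomputable section

namespace MasterLagrangian

open MvPolynomial

/-! Put `p_j = a_j / f_j`. The critical equations become linear, `bᵀ p = 0`, and the definition of
`f_j` reads `z = a / p - b t`. So `Λ` consists of the points of the phase space with `p` in the
kernel of `bᵀ` and `a / p - z` in the column space of `b` (`mem_lagrangianSet_iff`). It is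
parametrized by `(p, t)`, that is, by an open subset `V` of an affine space of dimension `(n - k) +
k = n`.

The relations express these two conditions over every `ℂ`-algebra. By Cramer's rule the coefficient
vectors of the first kind span a space that contains the columns of `b` (`column_mem_span`). A
relation of second kind, divided by the unit `p_{i_1} ⋯ p_{i_{k+1}}`, is a discriminant form
evaluated at `z - a / p` (`aeval_relSecond`), and the discriminant forms span the annihilator of the
columns (`mem_span_discVec`). Hence the quotient map `𝒪(U) → 𝒪(U) / I`, with `I` the relation ideal,
factors through restriction to `V` (`exists_domain`). A function vanishing on `Λ` restricts to zero
on `V`, so it lies in `I`, and the quotient is `𝒪(V)`, a localization of a polynomial ring, hence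
smooth.

Tangent vectors are velocities of the parametrization. Isotropy follows from the symmetry of the
derivative of `a / p` and from the orthogonality of the kernel of `bᵀ` and the image of `b`. For
nonemptiness, a generic `p` in the kernel must avoid the discriminant at `z = a / p`; when `n = k +
1` this is where `∑ a_j ≠ 0` enters. -/

/-! Regular functions on a principal open subset of affine space -/

section PrincipalOpen

variable {σ τ : Type}

/-- The homomorphism from polynomials to regular functions on `U`. -/
def polyHom (U : Set (σ → ℂ)) : MvPolynomial σ ℂ →ₐ[ℂ] regularFunctions U where
  toFun := polyOn U
  map_one' := Subtype.ext <| funext fun x => by simp [polyOn]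
  map_mul' P Q := Subtype.ext <| funext fun x => by simp [polyOn]
  map_zero' := Subtype.ext <| funext fun x => by simp [polyOn]
  map_add' P Q := Subtype.ext <| funext fun x => by simp [polyOn]
  commutes' c := Subtype.ext <| funext fun x => by
    simp only [polyOn, MvPolynomial.algebraMap_eq, eval_C]; rfl

theorem polyHom_apply (U : Set (σ → ℂ)) (P : MvPolynomial σ ℂ) (x : U) :
    (polyHom U P).1 x = eval x.1 P := rfl

theorem isUnit_of_forall_ne_zero {U : Set (σ → ℂ)} (g : regularFunctions U)
    (hg : ∀ x, g.1 x ≠ 0) : IsUnit g := by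
  obtain ⟨P, Q, h⟩ := g.2
  refine IsUnit.of_mul_eq_one (⟨fun x => eval x.1 Q / eval x.1 P, Q, P, fun x => ⟨?_, rfl⟩⟩ :
    regularFunctions U) ?_
  · intro h0
    apply hg x
    rw [(h x).2, h0, zero_div]
  · ext x
    change g.1 x * (eval x.1 Q / eval x.1 P) = 1
    have h1 := hg x
    rw [(h x).2] at h1 ⊢
    rw [div_mul_div_cancel₀ (h x).1]
    exact div_self fun h0 => h1 (by rw [h0, zero_div])

theorem isUnit_polyHom {U : Set (σ → ℂ)} (P : MvPolynomial σ ℂ)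
    (hP : ∀ x ∈ U, eval x P ≠ 0) : IsUnit (polyHom U P) :=
  isUnit_of_forall_ne_zero _ fun x => hP x.1 x.2

/-- Every regular function is a quotient of polynomials. -/
theorem exists_mul_polyHom_eq {U : Set (σ → ℂ)} (g : regularFunctions U) :
    ∃ P Q : MvPolynomial σ ℂ, (∀ x ∈ U, eval x Q ≠ 0) ∧ g * polyHom U Q = polyHom U P := by
  obtain ⟨P, Q, h⟩ := g.2
  refine ⟨P, Q, fun x hx => (h ⟨x, hx⟩).1, ?_⟩
  ext x
  change g.1 x * eval x.1 Q = eval x.1 P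
  rw [(h x).2, div_mul_cancel₀ _ (h x).1]

/-- By the Nullstellensatz, a polynomial without zeros on `{H ≠ 0}` divides a power of `H`. -/
theorem exists_dvd_pow [Finite σ] (H Q : MvPolynomial σ ℂ)
    (h : ∀ x, eval x H ≠ 0 → eval x Q ≠ 0) : ∃ m : ℕ, Q ∣ H ^ m := by
  have h1 : H ∈ vanishingIdeal ℂ (zeroLocus ℂ (Ideal.span {Q})) := by
    rw [mem_vanishingIdeal_iff]
    intro x hx
    have h2 : eval x Q = 0 := by
      simpa using (mem_zeroLocus_iff.1 hx) Q (Ideal.mem_span_singleton_self Q)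
    by_contra h3
    exact h x (by simpa using h3) h2
  rw [vanishingIdeal_zeroLocus_eq_radical] at h1
  obtain ⟨m, hm⟩ := h1
  exact ⟨m, Ideal.mem_span_singleton.1 hm⟩

/-- Every denominator divides a power of `H`, so every regular function is a polynomial over a power
of `H`. Polynomials that agree on `U` agree everywhere after multiplication by `H`. -/
theorem isLocalization_regularFunctions [Finite σ] {U : Set (σ → ℂ)} (H : MvPolynomial σ ℂ)
    (hU : ∀ x, x ∈ U ↔ eval x H ≠ 0) :
    letI := (polyHom U).toRingHom.toAlgebra
    IsLocalization.Away H (regularFunctions U) := by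
  let _ := (polyHom U).toRingHom.toAlgebra
  have hmap : ∀ P, algebraMap (MvPolynomial σ ℂ) (regularFunctions U) P = polyHom U P :=
    fun _ => rfl
  refine (isLocalization_iff_isLocalizationMap ..).2 ⟨?_, ?_, ?_⟩
  · rintro ⟨_, m, rfl⟩
    rw [hmap]
    simp only [map_pow]
    exact (isUnit_polyHom H fun x hx => (hU x).1 hx).pow m
  · intro g
    obtain ⟨P, Q, hQ, hg⟩ := exists_mul_polyHom_eq g
    obtain ⟨m, R, hR⟩ := exists_dvd_pow H Q fun x hx => hQ x ((hU x).2 hx)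
    refine ⟨(P * R, ⟨H ^ m, m, rfl⟩), ?_⟩
    simp only [hmap]
    rw [hR, map_mul, map_mul, ← hg, mul_assoc]
  · intro P P' h
    refine ⟨⟨H, 1, pow_one H⟩, ?_⟩
    refine MvPolynomial.funext fun x => ?_
    simp only [map_mul]
    by_cases hx : eval x H = 0
    · simp [hx]
    · have h1 := congrArg (fun g : regularFunctions U => g.1 ⟨x, (hU x).2 hx⟩) h
      simp only [hmap, polyHom_apply] at h1
      rw [h1]

/-- The homomorphism out of `𝒪({H ≠ 0})` that extends a homomorphism of polynomials. -/
theorem exists_lift [Finite σ] {U : Set (σ → ℂ)} (H : MvPolynomial σ ℂ)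
    (hU : ∀ x, x ∈ U ↔ eval x H ≠ 0) {S : Type} [CommRing S] [Algebra ℂ S]
    (g : MvPolynomial σ ℂ →ₐ[ℂ] S) (hg : IsUnit (g H)) :
    ∃ G : regularFunctions U →ₐ[ℂ] S, ∀ P, G (polyHom U P) = g P := by
  let _ := (polyHom U).toRingHom.toAlgebra
  have := isLocalization_regularFunctions H hU
  let G : regularFunctions U →+* S := IsLocalization.Away.lift H (g := g.toRingHom) hg
  have hG : ∀ P, G (polyHom U P) = g P := fun P =>
    IsLocalization.Away.lift_eq H (g := g.toRingHom) hg P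
  refine ⟨{ G with commutes' := fun c => ?_ }, hG⟩
  have := hG (algebraMap ℂ _ c)
  rw [AlgHom.commutes, AlgHom.commutes] at this
  exact this

theorem algHom_ext_polyHom [Finite σ] {U : Set (σ → ℂ)}
    {S : Type} [CommRing S] [Algebra ℂ S] {G G' : regularFunctions U →ₐ[ℂ] S}
    (h : ∀ s, G (polyHom U (X s)) = G' (polyHom U (X s))) : G = G' := by
  have h1 : G.comp (polyHom U) = G'.comp (polyHom U) := MvPolynomial.algHom_ext h
  refine AlgHom.ext fun g => ?_
  obtain ⟨P, Q, hQ, hg⟩ := exists_mul_polyHom_eq g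
  have hu : IsUnit (G (polyHom U Q)) := (isUnit_polyHom Q hQ).map G
  have hP := DFunLike.congr_fun h1 P
  have hQ' := DFunLike.congr_fun h1 Q
  simp only [AlgHom.comp_apply] at hP hQ'
  refine hu.mul_right_cancel ?_
  rw [← map_mul, hg, hQ', ← map_mul, hg, hP]

theorem smooth_regularFunctions [Finite σ] {U : Set (σ → ℂ)} (H : MvPolynomial σ ℂ)
    (hU : ∀ x, x ∈ U ↔ eval x H ≠ 0) : Algebra.Smooth ℂ (regularFunctions U) := by
  let _ := (polyHom U).toRingHom.toAlgebra
  have := isLocalization_regularFunctions H hU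
  have : IsScalarTower ℂ (MvPolynomial σ ℂ) (regularFunctions U) :=
    IsScalarTower.of_algebraMap_eq fun c => ((polyHom U).commutes c).symm
  have : Algebra.Smooth (MvPolynomial σ ℂ) (regularFunctions U) :=
    Algebra.Smooth.of_isLocalization_Away H
  have : Algebra.Smooth ℂ (MvPolynomial σ ℂ) := ⟨inferInstance, inferInstance⟩
  exact Algebra.Smooth.comp ℂ (MvPolynomial σ ℂ) (regularFunctions U)

theorem aeval_regularFunctions_apply {V : Set (τ → ℂ)} (Θ : σ → regularFunctions V)
    (P : MvPolynomial σ ℂ) (v : V) :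
    (aeval Θ P).1 v = eval (fun s => (Θ s).1 v) P := by
  induction P using MvPolynomial.induction_on with
  | C c => rw [algHom_C, eval_C]; rfl
  | add p q hp hq => rw [map_add, map_add, ← hp, ← hq]; rfl
  | mul_X p i hp => rw [map_mul, map_mul, ← hp, aeval_X, eval_X]; rfl

/-- Composition of regular functions with a regular map, given by its coordinates. -/
def pullback {U : Set (σ → ℂ)} {V : Set (τ → ℂ)} (Θ : σ → regularFunctions V)
    (hΘ : ∀ v : V, (fun s => (Θ s).1 v) ∈ U) : regularFunctions U →ₐ[ℂ] regularFunctions V where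
  toFun g := ⟨fun v => g.1 ⟨_, hΘ v⟩, by
    obtain ⟨P, Q, h⟩ := g.2
    obtain ⟨u, hu⟩ := isUnit_of_forall_ne_zero (aeval Θ Q) fun v => by
      rw [aeval_regularFunctions_apply]
      exact (h ⟨_, hΘ v⟩).1
    -- The composite `P(Θ) / Q(Θ)` is regular because `Q(Θ)` has no zero on `V` and is therefore a
    -- unit.
    convert (aeval Θ P * (u⁻¹ : (regularFunctions V)ˣ).1 : regularFunctions V).2 using 1
    funext v
    have h1 : (u⁻¹ : (regularFunctions V)ˣ).1.1 v * (aeval Θ Q).1 v = 1 := by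
      rw [← hu]
      exact congrArg (fun g : regularFunctions V => g.1 v) u.inv_mul
    have h2 : (aeval Θ Q).1 v ≠ 0 := right_ne_zero_of_mul_eq_one h1
    change _ = (aeval Θ P).1 v * (u⁻¹ : (regularFunctions V)ˣ).1.1 v
    rw [(h _).2, eq_comm, ← aeval_regularFunctions_apply, ← aeval_regularFunctions_apply,
      eq_div_iff h2, mul_assoc, h1, mul_one]⟩
  map_one' := rfl
  map_mul' _ _ := rfl
  map_zero' := rfl
  map_add' _ _ := rfl
  commutes' _ := rfl

theorem pullback_apply {U : Set (σ → ℂ)} {V : Set (τ → ℂ)} (Θ : σ → regularFunctions V)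
    (hΘ : ∀ v : V, (fun s => (Θ s).1 v) ∈ U) (g : regularFunctions U) (v : V) :
    (pullback Θ hΘ g).1 v = g.1 ⟨_, hΘ v⟩ := rfl

theorem pullback_polyHom_X {U : Set (σ → ℂ)} {V : Set (τ → ℂ)} (Θ : σ → regularFunctions V)
    (hΘ : ∀ v : V, (fun s => (Θ s).1 v) ∈ U) (s : σ) :
    pullback Θ hΘ (polyHom U (X s)) = Θ s :=
  Subtype.ext <| funext fun v => by rw [pullback_apply, polyHom_apply, eval_X]

end PrincipalOpen

/-! Linear algebra of a generic matrix -/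

section LinearAlgebra

variable {n k : ℕ}

/-- The coefficients of the linear form `discForm b i`. -/
def discVec (b : Matrix (Fin n) (Fin k) ℂ) (i : Fin (k + 1) → Fin n) : Fin n → ℂ :=
  ∑ q : Fin (k + 1), ((-1) ^ (q : ℕ) * plucker b (fun l => i (q.succAbove l))) •
    Pi.single (i q) (1 : ℂ)

theorem sum_discVec_smul {M : Type} [AddCommGroup M] [Module ℂ M]
    (b : Matrix (Fin n) (Fin k) ℂ) (i : Fin (k + 1) → Fin n) (z : Fin n → M) :
    ∑ j, discVec b i j • z j =
      ∑ q : Fin (k + 1), ((-1) ^ (q : ℕ) * plucker b (fun l => i (q.succAbove l))) • z (i q) := by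
  simp only [discVec, Finset.sum_apply, Finset.sum_smul]
  rw [Finset.sum_comm]
  refine Finset.sum_congr rfl fun q _ => ?_
  simp [Pi.single_apply, ite_smul]

theorem discForm_eq {R : Type} [CommRing R] [Algebra ℂ R] (b : Matrix (Fin n) (Fin k) ℂ)
    (i : Fin (k + 1) → Fin n) (z : Fin n → R) :
    discForm b i z = ∑ j, discVec b i j • z j :=
  (sum_discVec_smul b i z).symm

/-- Laplace expansion along the adjoined column `z`. Repeated columns and repeated rows then give
the two vanishing statements below. -/
theorem discForm_eq_det (b : Matrix (Fin n) (Fin k) ℂ) (i : Fin (k + 1) → Fin n)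
    (z : Fin n → ℂ) :
    discForm b i z =
      (Matrix.of fun q : Fin (k + 1) => (Fin.cons (z (i q)) (b (i q)) : Fin (k + 1) → ℂ)).det := by
  rw [Matrix.det_succ_column_zero]
  refine Finset.sum_congr rfl fun q _ => ?_
  simp only [smul_eq_mul, Matrix.of_apply, Fin.cons_zero, plucker]
  rw [mul_right_comm]
  rfl

theorem discForm_column (b : Matrix (Fin n) (Fin k) ℂ) (i : Fin (k + 1) → Fin n) (m : Fin k) :
    discForm b i (fun j => b j m) = 0 := by
  rw [discForm_eq_det]
  refine Matrix.det_zero_of_column_eq (i := 0) (j := m.succ) (Fin.succ_ne_zero m).symm fun q => ?_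
  simp

theorem discVec_eq_zero (b : Matrix (Fin n) (Fin k) ℂ) (i : Fin (k + 1) → Fin n)
    (hi : ¬ Function.Injective i) : discVec b i = 0 := by
  have h : ∀ z : Fin n → ℂ, discForm b i z = 0 := fun z => by
    rw [discForm_eq_det]
    simp only [Function.Injective, not_forall] at hi
    obtain ⟨q, r, hqr, hne⟩ := hi
    refine Matrix.det_zero_of_row_eq hne ?_
    funext l
    simp [hqr]
  funext j
  have := h (Pi.single j 1)
  rw [discForm_eq] at this
  simpa [Pi.single_apply] using this

theorem discVec_vecMul (b : Matrix (Fin n) (Fin k) ℂ) (i : Fin (k + 1) → Fin n) :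
    Matrix.vecMul (discVec b i) b = 0 := by
  funext m
  have := discForm_column b i m
  rw [discForm_eq] at this
  simpa [Matrix.vecMul, dotProduct] using this

theorem consIndex_succ (j : Fin n) (i : Fin k → Fin n) :
    consIndex (k := k + 1) j i = Fin.cons j i := by
  funext l
  refine Fin.cases ?_ (fun l => ?_) l
  · simp [consIndex]
  · simp [consIndex]

/-- The expansion of a row of `b` in terms of the rows `i`. -/
theorem plucker_mul_eq (b : Matrix (Fin n) (Fin (k + 1)) ℂ) (i : Fin (k + 1) → Fin n)
    (j : Fin n) (m : Fin (k + 1)) :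
    plucker b i * b j m = ∑ l : Fin (k + 1), (-1) ^ (l : ℕ) * b (i l) m *
      plucker b (consIndex j fun q : Fin k => i (l.succAbove q)) := by
  -- Cramer's rule: in the vanishing form for the sequence `j, i`, the term that omits `j` is the
  -- left-hand side.
  have h := discForm_column b (Fin.cons j i) m
  simp only [discForm] at h
  rw [Fin.sum_univ_succ] at h
  simp only [Fin.val_zero, pow_zero, one_mul, Fin.zero_succAbove, Fin.cons_succ, Fin.cons_zero,
    smul_eq_mul, Fin.val_succ] at h
  rw [eq_neg_of_add_eq_zero_left h, ← Finset.sum_neg_distrib]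
  refine Finset.sum_congr rfl fun l _ => ?_
  have h1 : (fun q => (Fin.cons j i : Fin (k + 2) → Fin n) (l.succ.succAbove q)) =
      consIndex j fun q : Fin k => i (l.succAbove q) := by
    rw [consIndex_succ]
    funext q
    refine Fin.cases ?_ (fun q => ?_) q
    · simp
    · simp [Fin.succ_succAbove_succ]
  rw [h1]
  ring

/-- After division by the minor of the first `k` rows, `plucker_mul_eq` writes each row as a
combination of these rows, with coefficients `d_{j,…}`. Read as functions of `j`, these coefficients
are the vectors of the relations of first kind. -/
theorem column_mem_span (hk : 0 < k) (hkn : k < n) (b : Matrix (Fin n) (Fin k) ℂ)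
    (hb : IsGeneric b) (m : Fin k) :
    (fun j => b j m) ∈ Submodule.span ℂ {u : Fin n → ℂ | ∃ i : Fin (k - 1) → Fin n,
      Function.Injective i ∧ u = fun j => plucker b (consIndex j i)} := by
  obtain ⟨k, rfl⟩ : ∃ k', k = k' + 1 := ⟨k - 1, by omega⟩
  have hi : Function.Injective (Fin.castLE hkn.le) := Fin.castLE_injective hkn.le
  have h : (fun j => b j m) = ∑ l : Fin (k + 1),
      ((plucker b (Fin.castLE hkn.le))⁻¹ * ((-1) ^ (l : ℕ) * b (Fin.castLE hkn.le l) m)) •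
        fun j => plucker b (consIndex j fun q : Fin k => Fin.castLE hkn.le (l.succAbove q)) := by
    funext j
    simp only [Finset.sum_apply, Pi.smul_apply, smul_eq_mul, mul_assoc, ← Finset.mul_sum]
    rw [eq_inv_mul_iff_mul_eq₀ (hb _ hi), plucker_mul_eq]
    simp only [mul_assoc]
  rw [h]
  refine Submodule.sum_mem _ fun l _ => Submodule.smul_mem _ _ (Submodule.subset_span ?_)
  exact ⟨_, hi.comp Fin.succAbove_right_injective, rfl⟩

theorem eq_zero_of_vecMul_eq_zero (b : Matrix (Fin n) (Fin k) ℂ) (hb : IsGeneric b)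
    (i : Fin k → Fin n) (hi : Function.Injective i) (u : Fin n → ℂ)
    (hu : Matrix.vecMul u b = 0) (hsupp : ∀ j, j ∉ Set.range i → u j = 0) : u = 0 := by
  have h1 : Matrix.vecMul (u ∘ i) (b.submatrix i id) = 0 := by
    funext m
    have h2 := congrFun hu m
    simp only [Matrix.vecMul, dotProduct, Pi.zero_apply, Matrix.submatrix_apply, id,
      Function.comp_apply] at h2 ⊢
    rw [← h2]
    refine Finset.sum_of_injOn i hi.injOn (by simp) (fun j _ hj => ?_) fun _ _ => rfl
    rw [hsupp j (by simpa using hj), zero_mul]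
  have h3 : u ∘ i = 0 := Matrix.eq_zero_of_vecMul_eq_zero (hb i hi) h1
  funext j
  by_cases hj : j ∈ Set.range i
  · obtain ⟨l, rfl⟩ := hj
    exact congrFun h3 l
  · exact hsupp j hj

/-- A linear form that annihilates the column space of `b` is a combination of discriminant
forms. -/
theorem mem_span_discVec (hkn : k < n) (b : Matrix (Fin n) (Fin k) ℂ)
    (hb : IsGeneric b) (u : Fin n → ℂ) (hu : Matrix.vecMul u b = 0) :
    u ∈ Submodule.span ℂ {v : Fin n → ℂ | ∃ i : Fin (k + 1) → Fin n,
      Function.Injective i ∧ v = discVec b i} := by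
  set i₀ : Fin k → Fin n := Fin.castLE hkn.le with hi₀
  have hinj : Function.Injective i₀ := Fin.castLE_injective hkn.le
  have hd : plucker b i₀ ≠ 0 := hb _ hinj
  set N := Submodule.span ℂ {v : Fin n → ℂ | ∃ i : Fin (k + 1) → Fin n,
      Function.Injective i ∧ v = discVec b i} with hN
  have hmem : ∀ i : Fin (k + 1) → Fin n, discVec b i ∈ N := fun i => by
    by_cases hi : Function.Injective i
    · exact Submodule.subset_span ⟨i, hi, rfl⟩
    · rw [discVec_eq_zero b i hi]
      exact N.zero_mem
  -- Outside the range of `i₀`, the vector `discVec b (j, i₀)` is `d` times the basis vector at `j`,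
  -- so the difference is supported on the `k` independent rows `i₀` and must vanish. For `j` in the
  -- range of `i₀` the summand is zero.
  have h : plucker b i₀ • u - ∑ j, u j • discVec b (Fin.cons j i₀) = 0 := by
    refine eq_zero_of_vecMul_eq_zero b hb i₀ hinj _ ?_ fun j' hj' => ?_
    · rw [Matrix.sub_vecMul, Matrix.smul_vecMul, hu, Matrix.sum_vecMul]
      simp [Matrix.smul_vecMul, discVec_vecMul]
    · have h1 : ∀ j, discVec b (Fin.cons j i₀) j' =
          plucker b i₀ * (Pi.single j (1 : ℂ) : Fin n → ℂ) j' := fun j => by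
        have h2 : ∀ l, (Pi.single (i₀ l) (1 : ℂ) : Fin n → ℂ) j' = 0 := fun l =>
          Pi.single_eq_of_ne (fun h => hj' ⟨l, h.symm⟩) _
        simp only [discVec, Finset.sum_apply, Pi.smul_apply, smul_eq_mul]
        rw [Fin.sum_univ_succ]
        simp [h2]
      simp only [Pi.sub_apply, Pi.smul_apply, smul_eq_mul, Finset.sum_apply, h1]
      simp only [Pi.single_apply]
      simp [mul_comm]
  have h3 : u = (plucker b i₀)⁻¹ • ∑ j, u j • discVec b (Fin.cons j i₀) := by
    rw [← sub_eq_zero.1 h, smul_smul, inv_mul_cancel₀ hd, one_smul]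
  rw [h3]
  exact N.smul_mem _ (N.sum_mem fun j _ => N.smul_mem _ (hmem _))

theorem exists_left_inverse (hkn : k < n) (b : Matrix (Fin n) (Fin k) ℂ) (hb : IsGeneric b) :
    ∃ c : Matrix (Fin k) (Fin n) ℂ, c * b = 1 := by
  have h1 : Function.Injective b.toLin' := by
    rw [← LinearMap.ker_eq_bot, LinearMap.ker_eq_bot']
    intro x hx
    refine Matrix.eq_zero_of_mulVec_eq_zero (hb _ (Fin.castLE_injective hkn.le)) ?_
    funext l
    exact congrFun hx (Fin.castLE hkn.le l)
  obtain ⟨g, hg⟩ := LinearMap.exists_leftInverse_of_injective _ (LinearMap.ker_eq_bot.2 h1)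
  refine ⟨LinearMap.toMatrix' g, ?_⟩
  have := congrArg LinearMap.toMatrix' hg
  rwa [LinearMap.toMatrix'_comp, LinearMap.toMatrix'_toLin', LinearMap.toMatrix'_id] at this

/-- A parametrization `K` of the kernel of `bᵀ`, with its left inverse. -/
theorem exists_kernel_matrix (b : Matrix (Fin n) (Fin k) ℂ)
    (c : Matrix (Fin k) (Fin n) ℂ) (hc : c * b = 1) :
    ∃ (K : Matrix (Fin n) (Fin (n - k)) ℂ) (l : Matrix (Fin (n - k)) (Fin n) ℂ),
      b.transpose * K = 0 ∧ l * K = 1 ∧ K * l = 1 - c.transpose * b.transpose := by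
  set N := LinearMap.ker (Matrix.toLin' b.transpose) with hN
  have hbc : b.transpose * c.transpose = 1 := by
    rw [← Matrix.transpose_mul, hc, Matrix.transpose_one]
  have hsurj : LinearMap.range (Matrix.toLin' b.transpose) = ⊤ := by
    rw [LinearMap.range_eq_top]
    intro y
    refine ⟨Matrix.toLin' c.transpose y, ?_⟩
    rw [← LinearMap.comp_apply, ← Matrix.toLin'_mul, hbc, Matrix.toLin'_one, LinearMap.id_apply]
  have hfin : Module.finrank ℂ N = n - k := by
    have := LinearMap.finrank_range_add_finrank_ker (Matrix.toLin' b.transpose)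
    rw [hsurj, finrank_top, Module.finrank_fin_fun, Module.finrank_fin_fun, ← hN] at this
    omega
  let e : N ≃ₗ[ℂ] (Fin (n - k) → ℂ) := (Module.finBasisOfFinrankEq ℂ N hfin).equivFun
  -- As `bᵀ cᵀ = 1`, the matrix `1 - cᵀ bᵀ` is a projection onto the kernel of `bᵀ`. In coordinates
  -- on the kernel, `K` is the inclusion and `l` is this projection.
  have hproj : ∀ v, Matrix.toLin' (1 - c.transpose * b.transpose) v ∈ N := fun v => by
    rw [hN, LinearMap.mem_ker, ← LinearMap.comp_apply, ← Matrix.toLin'_mul, Matrix.mul_sub,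
      ← Matrix.mul_assoc, hbc]
    simp
  let π : (Fin n → ℂ) →ₗ[ℂ] N := (Matrix.toLin' (1 - c.transpose * b.transpose)).codRestrict N hproj
  have hπ : ∀ v : N, π v.1 = v := fun v => by
    ext1
    have hv : Matrix.mulVec b.transpose v.1 = 0 := v.2
    change Matrix.toLin' (1 - c.transpose * b.transpose) v.1 = v.1
    rw [Matrix.toLin'_apply, Matrix.sub_mulVec, ← Matrix.mulVec_mulVec, hv]
    simp
  refine ⟨LinearMap.toMatrix' (N.subtype ∘ₗ e.symm.toLinearMap),
    LinearMap.toMatrix' (e.toLinearMap ∘ₗ π), ?_, ?_, ?_⟩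
  · apply Matrix.toLin'.injective
    rw [Matrix.toLin'_mul, Matrix.toLin'_toMatrix']
    refine LinearMap.ext fun s => ?_
    rw [map_zero]
    exact (e.symm s).2
  · rw [← LinearMap.toMatrix'_comp, ← LinearMap.toMatrix'_id]
    congr 1
    refine LinearMap.ext fun s => ?_
    change e (π (e.symm s).1) = s
    rw [hπ, LinearEquiv.apply_symm_apply]
  · rw [← LinearMap.toMatrix'_comp, ← LinearMap.toMatrix'_toLin' (1 - c.transpose * b.transpose)]
    congr 1
    refine LinearMap.ext fun s => ?_
    change (e.symm (e (π s))).1 = _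
    rw [LinearEquiv.symm_apply_apply]
    rfl

/-! ### Generic points of a linear space -/

theorem eval_aeval {σ τ : Type} (g : σ → MvPolynomial τ ℂ) (P : MvPolynomial σ ℂ) (s : τ → ℂ) :
    eval s (aeval g P) = eval (fun x => eval s (g x)) P := by
  induction P using MvPolynomial.induction_on with
  | C c => simp
  | add p q hp hq => rw [map_add, map_add, map_add, hp, hq]
  | mul_X p i hp => rw [map_mul, map_mul, map_mul, hp, aeval_X, eval_X]

/-- Finitely many polynomials, none of which vanishes identically on a linear space, have a common
non-zero in that space. -/
theorem exists_forall_eval_ne_zero {σ τ ι : Type} [Finite ι] [Fintype τ] (K : Matrix σ τ ℂ)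
    (P : ι → MvPolynomial σ ℂ) (h : ∀ i, ∃ s, eval (Matrix.mulVec K s) (P i) ≠ 0) :
    ∃ s, ∀ i, eval (Matrix.mulVec K s) (P i) ≠ 0 := by
  have := Fintype.ofFinite ι
  let Q : ι → MvPolynomial τ ℂ := fun i => aeval (fun x => ∑ s, C (K x s) * X s) (P i)
  have hQ : ∀ i s, eval s (Q i) = eval (Matrix.mulVec K s) (P i) := fun i s => by
    have h2 : (fun x => eval s (∑ s, C (K x s) * X s : MvPolynomial τ ℂ)) = Matrix.mulVec K s := by
      funext x
      simp [Matrix.mulVec, dotProduct]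
    rw [eval_aeval, h2]
  -- The polynomial ring is a domain, so one non-zero of the product serves all indices.
  have h1 : ∏ i, Q i ≠ 0 := by
    rw [Finset.prod_ne_zero_iff]
    rintro i - h0
    obtain ⟨s, hs⟩ := h i
    rw [← hQ, h0, map_zero] at hs
    exact hs rfl
  by_contra! hcon
  apply h1
  refine MvPolynomial.funext fun s => ?_
  obtain ⟨i, hi⟩ := hcon s
  rw [map_prod, map_zero]
  exact Finset.prod_eq_zero (Finset.mem_univ i) (by rw [hQ, hi])

end LinearAlgebra

/-! Points of the Lagrangian set -/

section Points

variable {n k : ℕ}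

/-- The substitution `f_j = a_j / p_j` makes the critical equations linear in `p`; all later
arguments use this description instead of `phi`. -/
theorem mem_lagrangianSet_iff (a : Fin n → ℂ) (ha : ∀ j, a j ≠ 0) (b : Matrix (Fin n) (Fin k) ℂ)
    (x : Fin n ⊕ Fin n → ℂ) :
    x ∈ lagrangianSet a b ↔ x ∈ phaseSpace b ∧ (∀ m, ∑ j, b j m * x (Sum.inr j) = 0) ∧
      ∃ t : Fin k → ℂ, ∀ j, x (Sum.inl j) = a j / x (Sum.inr j) - ∑ m, b j m * t m := by
  constructor
  · rintro ⟨⟨z, t⟩, ⟨hz, hf, hc⟩, rfl⟩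
    simp only [masterDerivT_eq] at hc
    simp only [phi, masterDerivZ_eq, phaseSpace, Set.mem_ofPred_eq, Sum.elim_inl, Sum.elim_inr]
    refine ⟨⟨hz, fun j => div_ne_zero (ha j) (hf j)⟩, hc, t, fun j => ?_⟩
    rw [div_div_cancel₀ (ha j), f, add_sub_cancel_right]
  · rintro ⟨⟨hz, hp⟩, hker, t, ht⟩
    have hf : ∀ j, f b j (fun j => x (Sum.inl j)) t = a j / x (Sum.inr j) := fun j => by
      rw [f, ht j, sub_add_cancel]
    have hf' : ∀ j, a j / f b j (fun j => x (Sum.inl j)) t = x (Sum.inr j) := fun j => by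
      rw [hf, div_div_cancel₀ (ha j)]
    refine ⟨(fun j => x (Sum.inl j), t), ⟨hz, fun j => ?_, fun m => ?_⟩, ?_⟩
    · rw [hf]
      exact div_ne_zero (ha j) (hp j)
    · rw [masterDerivT_eq]
      simpa only [hf'] using hker m
    · funext s
      rcases s with j | j
      · rfl
      · simp only [phi, Sum.elim_inr, masterDerivZ_eq, hf']

theorem discVec_apply (b : Matrix (Fin n) (Fin k) ℂ) (i : Fin (k + 1) → Fin n)
    (hi : Function.Injective i) (q : Fin (k + 1)) :
    discVec b i (i q) = (-1) ^ (q : ℕ) * plucker b (fun l => i (q.succAbove l)) := by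
  simp only [discVec, Finset.sum_apply, Pi.smul_apply, smul_eq_mul, Pi.single_apply, hi.eq_iff]
  simp

theorem discVec_apply_ne_zero (b : Matrix (Fin n) (Fin k) ℂ) (hb : IsGeneric b)
    (i : Fin (k + 1) → Fin n) (hi : Function.Injective i) (q : Fin (k + 1)) :
    discVec b i (i q) ≠ 0 := by
  rw [discVec_apply b i hi]
  exact mul_ne_zero (pow_ne_zero _ (by norm_num))
    (hb _ (hi.comp Fin.succAbove_right_injective))

theorem discVec_of_notMem_range (b : Matrix (Fin n) (Fin k) ℂ) (i : Fin (k + 1) → Fin n)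
    (j : Fin n) (hj : j ∉ Set.range i) : discVec b i j = 0 := by
  simp only [discVec, Finset.sum_apply, Pi.smul_apply, smul_eq_mul]
  refine Finset.sum_eq_zero fun q _ => ?_
  rw [Pi.single_eq_of_ne fun h => hj ⟨q, h.symm⟩, mul_zero]

/-- The polynomial `(∏ p) · discForm (a / p)` on the space with coordinates `p`. -/
def discNumerator (a : Fin n → ℂ) (b : Matrix (Fin n) (Fin k) ℂ) (i : Fin (k + 1) → Fin n) :
    MvPolynomial (Fin n) ℂ :=
  ∑ m : Fin (k + 1), C ((-1) ^ (m : ℕ) * plucker b (fun l => i (m.succAbove l)) * a (i m)) *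
    ∏ l : Fin k, X (i (m.succAbove l))

theorem eval_discNumerator (a : Fin n → ℂ) (b : Matrix (Fin n) (Fin k) ℂ)
    (i : Fin (k + 1) → Fin n) (p : Fin n → ℂ) :
    eval p (discNumerator a b i) = ∑ m : Fin (k + 1),
      (-1) ^ (m : ℕ) * plucker b (fun l => i (m.succAbove l)) * a (i m) *
        ∏ l : Fin k, p (i (m.succAbove l)) := by
  simp only [discNumerator, map_sum, map_mul, map_prod, eval_C, eval_X]

theorem eval_discNumerator_eq (a : Fin n → ℂ) (b : Matrix (Fin n) (Fin k) ℂ)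
    (i : Fin (k + 1) → Fin n) (p : Fin n → ℂ) (hp : ∀ j, p j ≠ 0) :
    eval p (discNumerator a b i) = (∏ q, p (i q)) * discForm b i (fun j => a j / p j) := by
  rw [eval_discNumerator, discForm, Finset.mul_sum]
  refine Finset.sum_congr rfl fun m _ => ?_
  rw [Fin.prod_univ_succAbove _ m, smul_eq_mul]
  have := hp (i m)
  field_simp

/-- If `i` exhausts all indices, take `p = discVec b i`: each term is `∏ p` times some `a_j`, and
the sum is `(∏ p) ∑ a_j`. Otherwise exchange `i 0` for an index `j` outside `i`: the resulting
`discVec` vanishes at `i 0`, so only the term whose product omits `i 0` survives. -/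
theorem exists_eval_discNumerator_ne_zero (b : Matrix (Fin n) (Fin k) ℂ)
    (hb : IsGeneric b) (a : Fin n → ℂ) (ha : ∀ j, a j ≠ 0) (hsum : ∑ j, a j ≠ 0)
    (i : Fin (k + 1) → Fin n) (hi : Function.Injective i) :
    ∃ p, Matrix.vecMul p b = 0 ∧ eval p (discNumerator a b i) ≠ 0 := by
  by_cases hsurj : Function.Surjective i
  · refine ⟨discVec b i, discVec_vecMul b i, ?_⟩
    have h : eval (discVec b i) (discNumerator a b i) =
        (∏ q, discVec b i (i q)) * ∑ j, a j := by
      rw [eval_discNumerator, ← Function.Bijective.sum_comp (show Function.Bijective i from ⟨hi, hsurj⟩) a,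
        Finset.mul_sum]
      refine Finset.sum_congr rfl fun m _ => ?_
      rw [Fin.prod_univ_succAbove _ m, discVec_apply b i hi m]
      ring
    rw [h]
    exact mul_ne_zero (Finset.prod_ne_zero_iff.2 fun q _ => discVec_apply_ne_zero b hb i hi q) hsum
  · simp only [Function.Surjective, not_forall, not_exists] at hsurj
    obtain ⟨j, hj⟩ := hsurj
    have hi' : Function.Injective (Fin.cons j (Fin.tail i) : Fin (k + 1) → Fin n) := by
      rw [Fin.cons_injective_iff]
      refine ⟨?_, hi.comp (Fin.succ_injective _)⟩
      rintro ⟨l, hl⟩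
      exact hj _ hl
    refine ⟨discVec b (Fin.cons j (Fin.tail i)), discVec_vecMul b _, ?_⟩
    have h0 : discVec b (Fin.cons j (Fin.tail i)) (i 0) = 0 := by
      refine discVec_of_notMem_range b _ _ ?_
      rintro ⟨l, hl⟩
      revert hl
      refine Fin.cases ?_ (fun l => ?_) l
      · intro h
        exact hj 0 h.symm
      · intro h
        exact Fin.succ_ne_zero l (hi h)
    have h1 : ∀ l : Fin k, discVec b (Fin.cons j (Fin.tail i)) (i l.succ) ≠ 0 := fun l =>
      discVec_apply_ne_zero b hb _ hi' l.succ
    rw [eval_discNumerator, Fin.sum_univ_succ, Finset.sum_eq_zero, add_zero]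
    · simp only [Fin.zero_succAbove]
      refine mul_ne_zero (mul_ne_zero (mul_ne_zero (by simp) ?_) (ha _))
        (Finset.prod_ne_zero_iff.2 fun l _ => h1 l)
      exact hb _ (hi.comp (Fin.succ_injective _))
    · intro m _
      obtain ⟨l, hl⟩ := Fin.exists_succAbove_eq (x := 0) (y := m.succ) (Fin.succ_ne_zero m).symm
      rw [Finset.prod_eq_zero (Finset.mem_univ l) (by rw [hl, h0]), mul_zero]

theorem exists_discVec_ne_zero (hkn : k < n) (b : Matrix (Fin n) (Fin k) ℂ)
    (hb : IsGeneric b) (j : Fin n) : ∃ p, Matrix.vecMul p b = 0 ∧ p j ≠ 0 := by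
  -- Any `k + 1` distinct indices containing `j` would do; the swap puts `j` first.
  let i : Fin (k + 1) → Fin n := Equiv.swap (Fin.castLE hkn 0) j ∘ Fin.castLE hkn
  have hi : Function.Injective i := (Equiv.injective _).comp (Fin.castLE_injective hkn)
  have h0 : i 0 = j := Equiv.swap_apply_left _ _
  refine ⟨discVec b i, discVec_vecMul b i, ?_⟩
  have := discVec_apply_ne_zero b hb i hi 0
  rwa [h0] at this

/-- A point with `t = 0` and `z = a / p` exists for generic `p` in the kernel of `bᵀ`: no coordinate
`p_j` and no numerator of a discriminant form at `a / p` vanishes identically there. -/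
theorem lagrangianSet_nonempty (hkn : k < n) (b : Matrix (Fin n) (Fin k) ℂ)
    (hb : IsGeneric b) (a : Fin n → ℂ) (ha : ∀ j, a j ≠ 0) (hsum : ∑ j, a j ≠ 0) :
    (lagrangianSet a b).Nonempty := by
  obtain ⟨c, hc⟩ := exists_left_inverse hkn b hb
  obtain ⟨K, l, hbK, -, hKl⟩ := exists_kernel_matrix b c hc
  have hker : ∀ p, Matrix.vecMul p b = 0 → Matrix.mulVec K (Matrix.mulVec l p) = p := fun p hp => by
    rw [Matrix.mulVec_mulVec, hKl, Matrix.sub_mulVec, ← Matrix.mulVec_mulVec,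
      Matrix.mulVec_transpose b, hp]
    simp
  let P : Fin n ⊕ {i : Fin (k + 1) → Fin n // Function.Injective i} → MvPolynomial (Fin n) ℂ :=
    Sum.elim X fun i => discNumerator a b i.1
  obtain ⟨s, hs⟩ := exists_forall_eval_ne_zero K P fun i => by
    rcases i with j | ⟨i, hi⟩
    · obtain ⟨p, hp, hpj⟩ := exists_discVec_ne_zero hkn b hb j
      exact ⟨Matrix.mulVec l p, by simpa [P, hker p hp] using hpj⟩
    · obtain ⟨p, hp, hpi⟩ := exists_eval_discNumerator_ne_zero b hb a ha hsum i hi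
      exact ⟨Matrix.mulVec l p, by simpa [P, hker p hp] using hpi⟩
  set p := Matrix.mulVec K s with hp
  have hp0 : ∀ j, p j ≠ 0 := fun j => by simpa [P] using hs (Sum.inl j)
  refine ⟨Sum.elim (fun j => a j / p j) p, (mem_lagrangianSet_iff a ha b _).2
    ⟨⟨?_, hp0⟩, fun m => ?_, 0, fun j => by simp⟩⟩
  · rintro ⟨i, hi, h0⟩
    refine hs (Sum.inr ⟨i, hi.injective⟩) ?_
    change eval p (discNumerator a b i) = 0
    rw [eval_discNumerator_eq a b i p hp0]
    exact mul_eq_zero_of_right _ h0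
  · have h1 : Matrix.mulVec b.transpose p = 0 := by
      rw [hp, Matrix.mulVec_mulVec, hbK, Matrix.zero_mulVec]
    exact congrFun h1 m

end Points

/-! The parametrization of the Lagrangian set and the ideal of relations -/

section Parametrization

variable {n k : ℕ}

/-- The inverse of a polynomial without zeros on `U`. -/
def invOn {σ : Type} (U : Set (σ → ℂ)) (Q : MvPolynomial σ ℂ) (hQ : ∀ x ∈ U, eval x Q ≠ 0) :
    regularFunctions U :=
  ⟨fun x => 1 / eval x.1 Q, 1, Q, fun x => ⟨hQ x.1 x.2, by simp⟩⟩

theorem polyHom_mul_invOn {σ : Type} (U : Set (σ → ℂ)) (Q : MvPolynomial σ ℂ)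
    (hQ : ∀ x ∈ U, eval x Q ≠ 0) : polyHom U Q * invOn U Q hQ = 1 :=
  Subtype.ext <| funext fun x => mul_one_div_cancel (hQ x.1 x.2)

/-- The polynomial whose non-vanishing locus is the phase space. -/
theorem exists_phaseSpace_eq (b : Matrix (Fin n) (Fin k) ℂ) :
    ∃ H : MvPolynomial (Fin n ⊕ Fin n) ℂ, ∀ x, x ∈ phaseSpace b ↔ eval x H ≠ 0 := by
  classical
  refine ⟨(∏ i : {i : Fin (k + 1) → Fin n // StrictMono i},
    discForm b i.1 (fun j => X (Sum.inl j))) * ∏ j, X (Sum.inr j), fun x => ?_⟩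
  have h : ∀ i : Fin (k + 1) → Fin n, eval x (discForm b i (fun j => X (Sum.inl j))) =
      discForm b i fun j => x (Sum.inl j) := fun i => by
    simp only [discForm, map_sum, smul_eval, eval_X, smul_eq_mul]
  simp only [map_mul, map_prod, h, eval_X, phaseSpace, discriminant, Set.mem_ofPred_eq, ne_eq,
    mul_eq_zero, Finset.prod_eq_zero_iff, Finset.mem_univ, true_and, not_or, not_exists,
    Subtype.forall, not_and]

/-- The polynomials `∑ₛ A j s xₛ`, for a matrix `A` and some of the coordinates. -/
def linPoly {σ ι κ : Type} [Fintype κ] (A : Matrix ι κ ℂ) (e : κ → σ) (j : ι) :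
    MvPolynomial σ ℂ :=
  ∑ s, A j s • X (e s)

theorem eval_linPoly {σ ι κ : Type} [Fintype κ] (A : Matrix ι κ ℂ) (e : κ → σ) (j : ι)
    (x : σ → ℂ) : eval x (linPoly A e j) = Matrix.mulVec A (x ∘ e) j := by
  simp [linPoly, smul_eval, Matrix.mulVec, dotProduct]

theorem sum_smul_sum_smul {M ι κ ν : Type} [AddCommGroup M] [Module ℂ M] [Fintype κ] [Fintype ν]
    (A : Matrix ι κ ℂ) (B : Matrix κ ν ℂ) (x : ν → M) (j : ι) :
    ∑ s, A j s • ∑ r, B s r • x r = ∑ r, (A * B) j r • x r := by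
  simp only [Finset.smul_sum, smul_smul, Matrix.mul_apply, Finset.sum_smul]
  exact Finset.sum_comm

/-- The parametrization `(s, t) ↦ (a / Ks - bt, Ks)` of the Lagrangian set. -/
def param (a : Fin n → ℂ) (b : Matrix (Fin n) (Fin k) ℂ) (K : Matrix (Fin n) (Fin (n - k)) ℂ)
    (v : Fin (n - k) ⊕ Fin k → ℂ) : Fin n ⊕ Fin n → ℂ :=
  Sum.elim (fun j => a j / Matrix.mulVec K (v ∘ Sum.inl) j - Matrix.mulVec b (v ∘ Sum.inr) j)
    (Matrix.mulVec K (v ∘ Sum.inl))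

/-- The coordinates of the parametrization as regular functions. -/
def paramCoord (a : Fin n → ℂ) (b : Matrix (Fin n) (Fin k) ℂ)
    (K : Matrix (Fin n) (Fin (n - k)) ℂ) (V : Set (Fin (n - k) ⊕ Fin k → ℂ))
    (hV : ∀ j, ∀ v ∈ V, eval v (linPoly K Sum.inl j) ≠ 0) :
    Fin n ⊕ Fin n → regularFunctions V :=
  Sum.elim (fun j => a j • invOn V _ (hV j) - polyHom V (linPoly b Sum.inr j))
    (fun j => polyHom V (linPoly K Sum.inl j))

theorem paramCoord_apply (a : Fin n → ℂ) (b : Matrix (Fin n) (Fin k) ℂ)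
    (K : Matrix (Fin n) (Fin (n - k)) ℂ) (V : Set (Fin (n - k) ⊕ Fin k → ℂ))
    (hV : ∀ j, ∀ v ∈ V, eval v (linPoly K Sum.inl j) ≠ 0) (v : V) :
    (fun s => (paramCoord a b K V hV s).1 v) = param a b K v := by
  funext s
  rcases s with j | j
  · change a j * (1 / eval v.1 (linPoly K Sum.inl j)) - eval v.1 (linPoly b Sum.inr j) = _
    rw [eval_linPoly, eval_linPoly, mul_one_div]
    rfl
  · exact eval_linPoly _ _ _ _

/-! ### Consequences of the relations in an arbitrary algebra -/

/-- The homomorphisms out of `𝒪(U)` that vanish on the relations. -/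
structure SatisfiesRelations (a : Fin n → ℂ) (b : Matrix (Fin n) (Fin k) ℂ) {S : Type}
    [CommRing S] [Algebra ℂ S] (ψ : regularFunctions (phaseSpace b) →ₐ[ℂ] S) : Prop where
  first : ∀ i : Fin (k - 1) → Fin n, Function.Injective i →
    ψ (polyHom (phaseSpace b) (relFirst b i)) = 0
  second : ∀ i : Fin (k + 1) → Fin n, Function.Injective i →
    ψ (polyHom (phaseSpace b) (relSecond a b i)) = 0

variable {a : Fin n → ℂ} {b : Matrix (Fin n) (Fin k) ℂ} {S : Type} [CommRing S] [Algebra ℂ S]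

/-- The relations of first kind are linear in `p`, so they pass to the span of their coefficient
vectors. The algebra `S` is left arbitrary to cover both points (`S = ℂ`) and the quotient by the
relation ideal. -/
theorem SatisfiesRelations.sum_column_eq_zero (hk : 0 < k) (hkn : k < n) (hb : IsGeneric b)
    {ψ : regularFunctions (phaseSpace b) →ₐ[ℂ] S} (hψ : SatisfiesRelations a b ψ) (m : Fin k) :
    ∑ j, b j m • ψ (polyHom (phaseSpace b) (X (Sum.inr j))) = 0 := by
  have h : ∀ u ∈ Submodule.span ℂ {u : Fin n → ℂ | ∃ i : Fin (k - 1) → Fin n,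
      Function.Injective i ∧ u = fun j => plucker b (consIndex j i)},
      ∑ j, u j • ψ (polyHom (phaseSpace b) (X (Sum.inr j))) = 0 := fun u hu => by
    induction hu using Submodule.span_induction with
    | mem u hu =>
      obtain ⟨i, hi, rfl⟩ := hu
      rw [← hψ.first i hi, relFirst]
      simp only [map_sum, ← smul_eq_C_mul, map_smul]
    | zero => simp
    | add u v _ _ hu hv =>
      simp only [Pi.add_apply, add_smul, Finset.sum_add_distrib, hu, hv, add_zero]
    | smul c u _ hu =>
      simp only [Pi.smul_apply, smul_eq_mul, mul_smul, ← Finset.smul_sum, hu, smul_zero]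
  exact h _ (column_mem_span hk hkn b hb m)

/-- With `P'` in the role of `1 / p`, the factor `p_{i_m}` missing from the `m`-th product is
restored by `P'`; what remains is linear in `z - a / p`. -/
theorem aeval_relSecond (P Z P' : Fin n → S) (hP : ∀ j, P j * P' j = 1)
    (i : Fin (k + 1) → Fin n) :
    aeval (Sum.elim Z P) (relSecond a b i) =
      (∏ q, P (i q)) * ∑ j, discVec b i j • (Z j - a j • P' j) := by
  rw [sum_discVec_smul]
  simp only [relSecond, discForm, ← smul_eq_C_mul]
  simp only [map_add, map_mul, map_prod, map_sum, map_smul, aeval_X,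
    Sum.elim_inl, Sum.elim_inr, smul_sub, Finset.sum_sub_distrib, mul_sub]
  rw [sub_eq_add_neg, add_right_inj, Finset.mul_sum, ← Finset.sum_neg_distrib]
  refine Finset.sum_congr rfl fun m _ => ?_
  rw [Fin.prod_univ_succAbove _ m, smul_smul, mul_smul_comm, mul_right_comm (P (i m)), hP, one_mul, ← neg_smul]
  congr 1
  ring

/-- The product of the `p_j` is a unit and can be cancelled from a relation of second kind;
`mem_span_discVec` then gives all annihilating forms. -/
theorem SatisfiesRelations.sum_eq_zero (hkn : k < n) (hb : IsGeneric b)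
    {ψ : regularFunctions (phaseSpace b) →ₐ[ℂ] S} (hψ : SatisfiesRelations a b ψ)
    (P' : Fin n → S) (hP : ∀ j, ψ (polyHom (phaseSpace b) (X (Sum.inr j))) * P' j = 1)
    (u : Fin n → ℂ) (hu : Matrix.vecMul u b = 0) :
    ∑ j, u j • (a j • P' j - ψ (polyHom (phaseSpace b) (X (Sum.inl j)))) = 0 := by
  have h : ∀ u ∈ Submodule.span ℂ {v : Fin n → ℂ | ∃ i : Fin (k + 1) → Fin n,
      Function.Injective i ∧ v = discVec b i},
      ∑ j, u j • (a j • P' j - ψ (polyHom (phaseSpace b) (X (Sum.inl j)))) = 0 := fun u hu => by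
    induction hu using Submodule.span_induction with
    | mem u hu =>
      obtain ⟨i, hi, rfl⟩ := hu
      have h1 := hψ.second i hi
      have h2 : ψ.comp (polyHom (phaseSpace b)) =
          aeval (Sum.elim (fun j => ψ (polyHom (phaseSpace b) (X (Sum.inl j))))
            (fun j => ψ (polyHom (phaseSpace b) (X (Sum.inr j))))) :=
        MvPolynomial.algHom_ext fun s => by rcases s with j | j <;> simp
      rw [← AlgHom.comp_apply, h2, aeval_relSecond _ _ P' hP] at h1
      have h3 : IsUnit (∏ q, ψ (polyHom (phaseSpace b) (X (Sum.inr (i q))))) :=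
        IsUnit.prod_univ_iff.2 fun q => IsUnit.of_mul_eq_one _ (hP _)
      rw [h3.mul_right_eq_zero] at h1
      rw [← neg_eq_zero, ← h1, ← Finset.sum_neg_distrib]
      simp only [← smul_neg, neg_sub]
    | zero => simp
    | add u v _ _ hu hv =>
      simp only [Pi.add_apply, add_smul, Finset.sum_add_distrib, hu, hv, add_zero]
    | smul c u _ hu =>
      simp only [Pi.smul_apply, smul_eq_mul, mul_smul, ← Finset.smul_sum, hu, smul_zero]
  exact h u (mem_span_discVec hkn b hb u hu)

/-- The homomorphism `s ↦ lp`, `t ↦ c(a / p - z)` from polynomials on the parameter space. -/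
def coordHom (a : Fin n → ℂ) (c : Matrix (Fin k) (Fin n) ℂ) (l : Matrix (Fin (n - k)) (Fin n) ℂ)
    (P Z P' : Fin n → S) : MvPolynomial (Fin (n - k) ⊕ Fin k) ℂ →ₐ[ℂ] S :=
  aeval (Sum.elim (fun s => ∑ j, l s j • P j) (fun m => ∑ j, c m j • (a j • P' j - Z j)))

theorem sum_one_smul {M ι : Type} [AddCommGroup M] [Module ℂ M] [Fintype ι] [DecidableEq ι]
    (x : ι → M) (j : ι) : ∑ r, (1 : Matrix ι ι ℂ) j r • x r = x j := by
  simp [Matrix.one_apply, ite_smul]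

/-- `K l P = P - cᵀ (bᵀ P)`, and `bᵀ P = 0`. -/
theorem coordHom_linPoly_inl {P Z P' : Fin n → S} (hP : ∀ m, ∑ j, b j m • P j = 0)
    {c : Matrix (Fin k) (Fin n) ℂ} {K : Matrix (Fin n) (Fin (n - k)) ℂ}
    {l : Matrix (Fin (n - k)) (Fin n) ℂ} (hKl : K * l = 1 - c.transpose * b.transpose)
    (j : Fin n) : coordHom a c l P Z P' (linPoly K Sum.inl j) = P j := by
  simp only [linPoly, coordHom, map_sum, map_smul, aeval_X, Sum.elim_inl]
  rw [sum_smul_sum_smul, hKl]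
  simp only [Matrix.sub_apply, sub_smul, Finset.sum_sub_distrib]
  rw [sum_one_smul, ← sum_smul_sum_smul]
  simp only [Matrix.transpose_apply, hP, smul_zero, Finset.sum_const_zero, sub_zero]

/-- The rows of `1 - b c` annihilate the columns of `b`, so `b c` fixes `a P' - Z`. -/
theorem coordHom_linPoly_inr {P Z P' : Fin n → S}
    (hZ : ∀ u, Matrix.vecMul u b = 0 → ∑ j, u j • (a j • P' j - Z j) = 0)
    {c : Matrix (Fin k) (Fin n) ℂ} (hc : c * b = 1) (l : Matrix (Fin (n - k)) (Fin n) ℂ)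
    (j : Fin n) : coordHom a c l P Z P' (linPoly b Sum.inr j) = a j • P' j - Z j := by
  simp only [linPoly, coordHom, map_sum, map_smul, aeval_X, Sum.elim_inr]
  rw [sum_smul_sum_smul, eq_comm, ← sub_eq_zero, ← sum_one_smul (fun j => a j • P' j - Z j) j,
    ← Finset.sum_sub_distrib]
  simp only [← sub_smul]
  refine hZ (fun r => (1 : Matrix (Fin n) (Fin n) ℂ) j r - (b * c) j r) ?_
  have h : (1 - b * c) * b = 0 := by
    rw [Matrix.sub_mul, Matrix.mul_assoc, hc, Matrix.one_mul, Matrix.mul_one, sub_self]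
  funext m
  exact congrFun (congrFun h j) m

/-- An `S`-valued point satisfying the linear conditions is recovered from its parameters `l P` and
`c (a P' - Z)`. -/
theorem apply_paramCoord {P Z P' : Fin n → S} (hPP' : ∀ j, P j * P' j = 1)
    (hP : ∀ m, ∑ j, b j m • P j = 0)
    (hZ : ∀ u, Matrix.vecMul u b = 0 → ∑ j, u j • (a j • P' j - Z j) = 0)
    {c : Matrix (Fin k) (Fin n) ℂ} (hc : c * b = 1)
    {K : Matrix (Fin n) (Fin (n - k)) ℂ} {l : Matrix (Fin (n - k)) (Fin n) ℂ}
    (hKl : K * l = 1 - c.transpose * b.transpose)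
    (V : Set (Fin (n - k) ⊕ Fin k → ℂ))
    (hV : ∀ j, ∀ v ∈ V, eval v (linPoly K Sum.inl j) ≠ 0)
    (G : regularFunctions V →ₐ[ℂ] S) (hG : ∀ Q, G (polyHom V Q) = coordHom a c l P Z P' Q)
    (s : Fin n ⊕ Fin n) :
    G (paramCoord a b K V hV s) = Sum.elim Z P s := by
  have hp : ∀ j, G (polyHom V (linPoly K Sum.inl j)) = P j := fun j => by
    rw [hG, coordHom_linPoly_inl hP hKl]
  rcases s with j | j
  · have hinv : G (invOn V _ (hV j)) = P' j := by
      have h1 := congrArg G (polyHom_mul_invOn V _ (hV j))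
      rw [map_mul, map_one, hp] at h1
      calc G (invOn V _ (hV j)) = (P j * P' j) * G (invOn V _ (hV j)) := by rw [hPP', one_mul]
        _ = P' j := by rw [mul_right_comm, h1, one_mul]
    rw [paramCoord, Sum.elim_inl, Sum.elim_inl, map_sub, map_smul, hinv, hG,
      coordHom_linPoly_inr hZ hc, sub_sub_cancel]
  · exact hp j

/-- The preimage of the phase space under the parametrization is a principal open set, and the
restriction to it is universal among the homomorphisms that vanish on the relations. -/
theorem exists_domain (hk : 0 < k) (hkn : k < n) (hb : IsGeneric b)
    (c : Matrix (Fin k) (Fin n) ℂ) (hc : c * b = 1)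
    (K : Matrix (Fin n) (Fin (n - k)) ℂ) (l : Matrix (Fin (n - k)) (Fin n) ℂ)
    (hKl : K * l = 1 - c.transpose * b.transpose)
    (V : Set (Fin (n - k) ⊕ Fin k → ℂ)) (hVdef : ∀ v, v ∈ V ↔ param a b K v ∈ phaseSpace b)
    (hV : ∀ j, ∀ v ∈ V, eval v (linPoly K Sum.inl j) ≠ 0) :
    ∃ H : MvPolynomial (Fin (n - k) ⊕ Fin k) ℂ, (∀ v, v ∈ V ↔ eval v H ≠ 0) ∧
      ∀ (S : Type) [CommRing S] [Algebra ℂ S] (ψ : regularFunctions (phaseSpace b) →ₐ[ℂ] S),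
        SatisfiesRelations a b ψ → ∃ G : regularFunctions V →ₐ[ℂ] S,
          ∀ s, G (paramCoord a b K V hV s) = ψ (polyHom (phaseSpace b) (X s)) := by
  set h : MvPolynomial (Fin (n - k) ⊕ Fin k) ℂ := ∏ j, linPoly K Sum.inl j with hh
  -- On `W` the parametrization is already regular, since the coordinates of `K s` are non-zero;
  -- avoiding the discriminant is imposed afterwards.
  set W : Set (Fin (n - k) ⊕ Fin k → ℂ) := {v | eval v h ≠ 0} with hW
  have hWV : ∀ j, ∀ v ∈ W, eval v (linPoly K Sum.inl j) ≠ 0 := fun j v hv h0 => by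
    refine hv ?_
    rw [hh, map_prod]
    exact Finset.prod_eq_zero (Finset.mem_univ j) h0
  obtain ⟨HU, hHU⟩ := exists_phaseSpace_eq b
  -- The equation of the phase space pulls back to `R / Q` on `W`, so `V` is the locus `h R ≠ 0`.
  obtain ⟨R, Q, hQ, hR⟩ := exists_mul_polyHom_eq (aeval (paramCoord a b K W hWV) HU)
  have hR' : ∀ v (_ : v ∈ W), eval (param a b K v) HU * eval v Q = eval v R := fun v hv => by
    have := congrArg (fun g : regularFunctions W => g.1 ⟨v, hv⟩) hR
    rw [← paramCoord_apply a b K W hWV ⟨v, hv⟩, ← aeval_regularFunctions_apply]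
    exact this
  have hmem : ∀ v, v ∈ V ↔ eval v (h * R) ≠ 0 := fun v => by
    rw [map_mul, mul_ne_zero_iff, hVdef]
    constructor
    · intro hv
      have hvW : v ∈ W := by
        change eval v h ≠ 0
        rw [hh, map_prod]
        exact Finset.prod_ne_zero_iff.2 fun j _ => hV j v ((hVdef v).2 hv)
      refine ⟨hvW, ?_⟩
      rw [← hR' v hvW]
      exact mul_ne_zero ((hHU _).1 hv) (hQ v hvW)
    · rintro ⟨hvW, hvR⟩
      rw [← hR' v hvW] at hvR
      exact (hHU _).2 (left_ne_zero_of_mul hvR)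
  refine ⟨h * R, hmem, fun S _ _ ψ hψ => ?_⟩
  · have hX : ∀ j, ∀ x ∈ phaseSpace b, eval x (X (Sum.inr j) : MvPolynomial _ ℂ) ≠ 0 :=
      fun j x hx => by
        rw [eval_X]
        exact hx.2 j
    let P' : Fin n → S := fun j => ψ (invOn _ _ (hX j))
    have hP : ∀ j, ψ (polyHom (phaseSpace b) (X (Sum.inr j))) * P' j = 1 := fun j => by
      rw [← map_mul, polyHom_mul_invOn, map_one]
    have hker := hψ.sum_column_eq_zero hk hkn hb
    have hZ := hψ.sum_eq_zero hkn hb P' hP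
    set β := coordHom a c l (fun j => ψ (polyHom (phaseSpace b) (X (Sum.inr j))))
      (fun j => ψ (polyHom (phaseSpace b) (X (Sum.inl j)))) P' with hβ
    have hβh : IsUnit (β h) := by
      rw [hh, map_prod]
      refine IsUnit.prod_univ_iff.2 fun j => ?_
      rw [hβ, coordHom_linPoly_inl hker hKl]
      exact IsUnit.of_mul_eq_one _ (hP j)
    obtain ⟨G₀, hG₀⟩ := exists_lift h (fun v => Iff.rfl : ∀ v, v ∈ W ↔ _) β hβh
    have hcomp : G₀.comp (aeval (paramCoord a b K W hWV)) = ψ.comp (polyHom (phaseSpace b)) :=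
      MvPolynomial.algHom_ext fun s => by
        rw [AlgHom.comp_apply, aeval_X, AlgHom.comp_apply,
          apply_paramCoord hP hker hZ hc hKl W hWV G₀ hG₀ s]
        rcases s with j | j <;> rfl
    -- The intermediate lift `G₀` to `𝒪(W)` is needed here: it sends the pullback of `HU` to `ψ` of
    -- `HU`, which is a unit, and `R` is that pullback times the unit `Q`.
    have hβR : IsUnit (β R) := by
      rw [← hG₀, ← hR, map_mul]
      refine IsUnit.mul ?_ ((isUnit_polyHom Q hQ).map G₀)
      rw [← AlgHom.comp_apply, hcomp]
      exact (isUnit_polyHom HU fun x hx => (hHU x).1 hx).map ψ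
    obtain ⟨G, hG⟩ := exists_lift (h * R) hmem β (by rw [map_mul]; exact hβh.mul hβR)
    refine ⟨G, fun s => ?_⟩
    rw [apply_paramCoord hP hker hZ hc hKl V hV G hG s]
    rcases s with j | j <;> rfl

end Parametrization

/-! The ideal of the Lagrangian set, its closedness and smoothness -/

section Ideal

variable {n k : ℕ} {a : Fin n → ℂ} {b : Matrix (Fin n) (Fin k) ℂ}

/-- Expansion of `d_{j,i}` along the row `j` gives a combination of the entries `b j m` whose
coefficients do not depend on `j`. -/
theorem eval_relFirst (hk : 0 < k) (i : Fin (k - 1) → Fin n) (x : Fin n ⊕ Fin n → ℂ)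
    (hx : ∀ m, ∑ j, b j m * x (Sum.inr j) = 0) : eval x (relFirst b i) = 0 := by
  obtain ⟨k, rfl⟩ : ∃ k', k = k' + 1 := ⟨k - 1, by omega⟩
  have h : ∀ j, plucker b (consIndex j i) = ∑ m : Fin (k + 1), b j m *
      ((-1) ^ (m : ℕ) * (b.submatrix (i : Fin k → Fin n) m.succAbove).det) := fun j => by
    rw [plucker, Matrix.det_succ_row_zero, consIndex_succ]
    refine Finset.sum_congr rfl fun m _ => ?_
    rw [mul_comm ((-1 : ℂ) ^ (m : ℕ)), mul_assoc]
    rfl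
  simp only [relFirst, map_sum, map_mul, eval_C, eval_X, h, Finset.sum_mul]
  rw [Finset.sum_comm]
  refine Finset.sum_eq_zero fun m _ => ?_
  rw [← zero_mul ((-1 : ℂ) ^ (m : ℕ) * (b.submatrix (i : Fin k → Fin n) m.succAbove).det),
    ← hx m, Finset.sum_mul]
  exact Finset.sum_congr rfl fun j _ => mul_right_comm _ _ _

theorem sum_mul_sum_eq_zero (u : Fin n → ℂ) (hu : Matrix.vecMul u b = 0) (t : Fin k → ℂ) :
    ∑ j, u j * ∑ m, b j m * t m = 0 := by
  simp only [Finset.mul_sum]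
  rw [Finset.sum_comm]
  refine Finset.sum_eq_zero fun m _ => ?_
  have h := congrFun hu m
  simp only [Matrix.vecMul, dotProduct, Pi.zero_apply] at h
  rw [← zero_mul (t m), ← h, Finset.sum_mul]
  exact Finset.sum_congr rfl fun j _ => (mul_assoc _ _ _).symm

/-- Here `z - a / p = -b t`, which every `discVec` annihilates. -/
theorem eval_relSecond (i : Fin (k + 1) → Fin n) (x : Fin n ⊕ Fin n → ℂ)
    (hx : ∀ j, x (Sum.inr j) ≠ 0) (t : Fin k → ℂ)
    (ht : ∀ j, x (Sum.inl j) = a j / x (Sum.inr j) - ∑ m, b j m * t m) :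
    eval x (relSecond a b i) = 0 := by
  have h := aeval_relSecond (a := a) (b := b) (fun j => x (Sum.inr j))
    (fun j => x (Sum.inl j)) (fun j => (x (Sum.inr j))⁻¹) (fun j => mul_inv_cancel₀ (hx j)) i
  have h1 : Sum.elim (fun j => x (Sum.inl j)) (fun j => x (Sum.inr j)) = x := by
    funext s
    rcases s with j | j <;> rfl
  rw [h1] at h
  rw [← MvPolynomial.coe_aeval_eq_eval]
  refine h.trans (mul_eq_zero_of_right _ ?_)
  have h2 : ∀ j, discVec b i j • (x (Sum.inl j) - a j • (x (Sum.inr j))⁻¹) =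
      -(discVec b i j * ∑ m, b j m * t m) := fun j => by
    rw [ht, smul_eq_mul, smul_eq_mul, div_eq_mul_inv]
    ring
  simp only [h2, Finset.sum_neg_distrib, sum_mul_sum_eq_zero _ (discVec_vecMul b i), neg_zero]

/-- A vector annihilated by all linear forms that annihilate the columns of `b` is in the column
space. -/
theorem exists_eq_sum_mul {c : Matrix (Fin k) (Fin n) ℂ} (hc : c * b = 1) (w : Fin n → ℂ)
    (hw : ∀ u, Matrix.vecMul u b = 0 → ∑ j, u j * w j = 0) :
    ∃ t : Fin k → ℂ, ∀ j, w j = ∑ m, b j m * t m := by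
  refine ⟨fun m => ∑ j, c m j • w j, fun j => ?_⟩
  -- With `a = 0` and `Z = -w`, the vector `a P' - Z` is `w`; the remaining arguments are
  -- irrelevant.
  have h := coordHom_linPoly_inr (a := 0) (P := w) (Z := -w) (P' := w) (b := b)
    (by simpa using hw) hc 0 j
  simp only [linPoly, coordHom, map_sum, map_smul, aeval_X, Sum.elim_inr] at h
  simpa using h.symm

/-- Evaluation of regular functions at a point. -/
def evalAt {σ : Type} {U : Set (σ → ℂ)} (x : U) : regularFunctions U →ₐ[ℂ] ℂ :=
  (Pi.evalAlgHom ℂ (fun _ : U => ℂ) x).comp (regularFunctions U).val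

theorem isZariskiClosedIn_lagrangianSet (hk : 0 < k) (hkn : k < n) (hb : IsGeneric b)
    (ha : ∀ j, a j ≠ 0) : IsZariskiClosedIn (phaseSpace b) (lagrangianSet a b) := by
  obtain ⟨c, hc⟩ := exists_left_inverse hkn b hb
  refine ⟨{P | ∃ i : Fin (k - 1) → Fin n, Function.Injective i ∧ P = relFirst b i} ∪
    {P | ∃ i : Fin (k + 1) → Fin n, Function.Injective i ∧ P = relSecond a b i},
    Set.ext fun x => ?_⟩
  rw [mem_lagrangianSet_iff a ha]
  constructor
  · rintro ⟨hxU, hx, t, ht⟩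
    refine ⟨hxU, ?_⟩
    rintro _ (⟨i, -, rfl⟩ | ⟨i, -, rfl⟩)
    · exact eval_relFirst hk i x hx
    · exact eval_relSecond i x hxU.2 t ht
  · rintro ⟨hxU, hx⟩
    -- Evaluation at `x` is a homomorphism to `ℂ`, so the algebraic consequences of the relations
    -- apply to points.
    have hψ : SatisfiesRelations a b (evalAt (⟨x, hxU⟩ : phaseSpace b)) :=
      ⟨fun i hi => hx _ (Or.inl ⟨i, hi, rfl⟩), fun i hi => hx _ (Or.inr ⟨i, hi, rfl⟩)⟩
    have hX : ∀ s, evalAt (⟨x, hxU⟩ : phaseSpace b) (polyHom (phaseSpace b) (X s)) = x s :=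
      fun s => eval_X s
    refine ⟨hxU, fun m => ?_, ?_⟩
    · simpa [hX] using hψ.sum_column_eq_zero hk hkn hb m
    · obtain ⟨t, ht⟩ := exists_eq_sum_mul hc
        (fun j => a j / x (Sum.inr j) - x (Sum.inl j)) fun u hu => by
          have := hψ.sum_eq_zero hkn hb (fun j => (x (Sum.inr j))⁻¹)
            (fun j => by rw [hX]; exact mul_inv_cancel₀ (hxU.2 j)) u hu
          simpa [hX, div_eq_mul_inv] using this
      exact ⟨t, fun j => by rw [← ht j, sub_sub_cancel]⟩

/-- A criterion for two nested ideals of `𝒪(U)` to coincide and to have a smooth quotient: the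
restriction to a principal open set has the larger ideal as its kernel, hits the coordinates, and
factors the quotient by the smaller ideal. -/
theorem ideal_eq_and_smooth_of_factorization {σ τ : Type} [Finite σ] [Finite τ]
    {U : Set (σ → ℂ)} {V : Set (τ → ℂ)} (H : MvPolynomial τ ℂ) (hH : ∀ v, v ∈ V ↔ eval v H ≠ 0)
    {I J : Ideal (regularFunctions U)} (hle : I ≤ J)
    (θ : regularFunctions U →ₐ[ℂ] regularFunctions V) (hker : ∀ g, θ g = 0 ↔ g ∈ J)
    (hgen : ∀ s, ∃ q, θ q = polyHom V (X s))
    (G : regularFunctions V →ₐ[ℂ] regularFunctions U ⧸ I)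
    (hG : ∀ g, G (θ g) = Ideal.Quotient.mk I g) :
    J = I ∧ Algebra.Smooth ℂ (regularFunctions U ⧸ J) := by
  constructor
  · refine le_antisymm (fun g hg => ?_) hle
    have h1 := hG g
    rw [(hker g).2 hg, map_zero] at h1
    exact Ideal.Quotient.eq_zero_iff_mem.1 h1.symm
  · let θ' : (regularFunctions U ⧸ I) →ₐ[ℂ] regularFunctions V :=
      Ideal.Quotient.liftₐ I θ fun g hg => (hker g).2 (hle hg)
    have hθ' : ∀ q, θ' (Ideal.Quotient.mk I q) = θ q := fun _ => rfl
    -- `θ' ∘ G` fixes the coordinates because they lie in the image of `θ`. Hence `θ` is surjective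
    -- and `𝒪(U) / J` is `𝒪(V)`.
    have h1 : θ'.comp G = AlgHom.id ℂ _ := algHom_ext_polyHom fun s => by
      obtain ⟨q, hq⟩ := hgen s
      rw [AlgHom.comp_apply, ← hq, hG, hθ', AlgHom.id_apply]
    have hsurj : Function.Surjective θ := fun g => by
      obtain ⟨q, hq⟩ := Ideal.Quotient.mk_surjective (G g)
      refine ⟨q, ?_⟩
      rw [← hθ', hq]
      exact DFunLike.congr_fun h1 g
    obtain rfl : RingHom.ker θ = J := Ideal.ext hker
    have hsm := smooth_regularFunctions H hH
    exact Algebra.Smooth.of_equiv (Ideal.quotientKerAlgEquivOfSurjective hsurj).symm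

variable {K : Matrix (Fin n) (Fin (n - k)) ℂ} {l : Matrix (Fin (n - k)) (Fin n) ℂ}

theorem param_mem_lagrangianSet (ha : ∀ j, a j ≠ 0) (hbK : b.transpose * K = 0)
    (v : Fin (n - k) ⊕ Fin k → ℂ) (hv : param a b K v ∈ phaseSpace b) :
    param a b K v ∈ lagrangianSet a b := by
  refine (mem_lagrangianSet_iff a ha b _).2 ⟨hv, fun m => ?_, v ∘ Sum.inr, fun j => rfl⟩
  have h1 : Matrix.mulVec b.transpose (Matrix.mulVec K (v ∘ Sum.inl)) = 0 := by
    rw [Matrix.mulVec_mulVec, hbK, Matrix.zero_mulVec]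
  exact congrFun h1 m

theorem mulVec_mulVec_of_mem_ker {c : Matrix (Fin k) (Fin n) ℂ}
    (hKl : K * l = 1 - c.transpose * b.transpose) (p : Fin n → ℂ)
    (hp : ∀ m, ∑ j, b j m * p j = 0) : Matrix.mulVec K (Matrix.mulVec l p) = p := by
  have h2 : Matrix.mulVec b.transpose p = 0 := funext hp
  rw [Matrix.mulVec_mulVec, hKl, Matrix.sub_mulVec, ← Matrix.mulVec_mulVec, h2]
  simp

theorem exists_param_eq (ha : ∀ j, a j ≠ 0) {c : Matrix (Fin k) (Fin n) ℂ}
    (hKl : K * l = 1 - c.transpose * b.transpose) (x : Fin n ⊕ Fin n → ℂ)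
    (hx : x ∈ lagrangianSet a b) : ∃ v, param a b K v = x := by
  obtain ⟨hxU, hker, t, ht⟩ := (mem_lagrangianSet_iff a ha b x).1 hx
  have h1 := mulVec_mulVec_of_mem_ker hKl _ hker
  refine ⟨Sum.elim (Matrix.mulVec l (fun j => x (Sum.inr j))) t, funext fun s => ?_⟩
  rcases s with j | j
  · simp only [param, Sum.elim_inl, Sum.elim_comp_inl, Sum.elim_comp_inr, h1, ht]
    rfl
  · simp only [param, Sum.elim_inr, Sum.elim_comp_inl, h1]

/-- The parameters are regular functions on the phase space. -/
theorem exists_regular_inverse {c : Matrix (Fin k) (Fin n) ℂ} (hc : c * b = 1) (hlK : l * K = 1)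
    (s : Fin (n - k) ⊕ Fin k) : ∃ q : regularFunctions (phaseSpace b),
      ∀ v (hv : param a b K v ∈ phaseSpace b), q.1 ⟨param a b K v, hv⟩ = v s := by
  have hX : ∀ j, ∀ x ∈ phaseSpace b, eval x (X (Sum.inr j) : MvPolynomial _ ℂ) ≠ 0 :=
    fun j x hx => by
      rw [eval_X]
      exact hx.2 j
  rcases s with s | m
  · refine ⟨∑ j, l s j • polyHom _ (X (Sum.inr j)), fun v hv => ?_⟩
    change evalAt ⟨param a b K v, hv⟩ _ = _
    have h1 : ∀ j, evalAt (⟨param a b K v, hv⟩ : phaseSpace b) (polyHom _ (X (Sum.inr j))) =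
        Matrix.mulVec K (v ∘ Sum.inl) j := fun j => eval_X _
    simp only [map_sum, map_smul, h1]
    have h2 : Matrix.mulVec l (Matrix.mulVec K (v ∘ Sum.inl)) = v ∘ Sum.inl := by
      rw [Matrix.mulVec_mulVec, hlK, Matrix.one_mulVec]
    exact congrFun h2 s
  · refine ⟨∑ j, c m j • (a j • invOn _ _ (hX j) - polyHom _ (X (Sum.inl j))), fun v hv => ?_⟩
    change evalAt ⟨param a b K v, hv⟩ _ = _
    have h1 : ∀ j, evalAt (⟨param a b K v, hv⟩ : phaseSpace b) (polyHom _ (X (Sum.inl j))) =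
        a j / Matrix.mulVec K (v ∘ Sum.inl) j - Matrix.mulVec b (v ∘ Sum.inr) j := fun j => eval_X _
    have h2 : ∀ j, evalAt (⟨param a b K v, hv⟩ : phaseSpace b) (invOn _ _ (hX j)) =
        1 / Matrix.mulVec K (v ∘ Sum.inl) j := fun j => by
      change 1 / eval (param a b K v) (X (Sum.inr j)) = _
      rw [eval_X]
      rfl
    simp only [map_sum, map_smul, map_sub, h1, h2, smul_eq_mul, mul_one_div, sub_sub_cancel]
    have h3 : Matrix.mulVec c (Matrix.mulVec b (v ∘ Sum.inr)) = v ∘ Sum.inr := by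
      rw [Matrix.mulVec_mulVec, hc, Matrix.one_mulVec]
    exact congrFun h3 m

theorem relationIdeal_le (hk : 0 < k) (ha : ∀ j, a j ≠ 0) :
    relationIdeal a b ≤ vanishingIdealOn (phaseSpace b) (lagrangianSet a b) := by
  refine Ideal.span_le.2 ?_
  rintro _ (⟨i, -, rfl⟩ | ⟨i, -, rfl⟩) x hx <;>
    obtain ⟨hxU, hx', t, ht⟩ := (mem_lagrangianSet_iff a ha b _).1 hx
  · exact eval_relFirst hk i x.1 hx'
  · exact eval_relSecond i x.1 hxU.2 t ht

theorem satisfiesRelations_mk :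
    SatisfiesRelations (S := regularFunctions (phaseSpace b) ⧸ relationIdeal a b) a b
      (Ideal.Quotient.mkₐ ℂ (relationIdeal a b)) :=
  ⟨fun i hi => Ideal.Quotient.eq_zero_iff_mem.2 (Ideal.subset_span (Or.inl ⟨i, hi, rfl⟩)),
    fun i hi => Ideal.Quotient.eq_zero_iff_mem.2 (Ideal.subset_span (Or.inr ⟨i, hi, rfl⟩))⟩

theorem vanishingIdealOn_eq_and_smooth (hk : 0 < k) (hkn : k < n) (hb : IsGeneric b)
    (ha : ∀ j, a j ≠ 0) :
    vanishingIdealOn (phaseSpace b) (lagrangianSet a b) = relationIdeal a b ∧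
      Algebra.Smooth ℂ
        (regularFunctions (phaseSpace b) ⧸ vanishingIdealOn (phaseSpace b) (lagrangianSet a b)) := by
  obtain ⟨c, hc⟩ := exists_left_inverse hkn b hb
  obtain ⟨K, l, hbK, hlK, hKl⟩ := exists_kernel_matrix b c hc
  let V : Set (Fin (n - k) ⊕ Fin k → ℂ) := {v | param a b K v ∈ phaseSpace b}
  have hV : ∀ j, ∀ v ∈ V, eval v (linPoly K Sum.inl j) ≠ 0 := fun j v hv => by
    rw [eval_linPoly]
    exact hv.2 j
  obtain ⟨H, hH, huniv⟩ := exists_domain (a := a) hk hkn hb c hc K l hKl V (fun v => Iff.rfl) hV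
  have hΘ : ∀ v : V, (fun s => (paramCoord a b K V hV s).1 v) ∈ phaseSpace b := fun v => by
    rw [paramCoord_apply]
    exact v.2
  -- The universal property is applied to the quotient map by the relation ideal; no prior knowledge
  -- that this ideal is radical is needed.
  obtain ⟨G, hG⟩ := huniv (regularFunctions (phaseSpace b) ⧸ relationIdeal a b) _ satisfiesRelations_mk
  have hval : ∀ g (v : V), (pullback (paramCoord a b K V hV) hΘ g).1 v =
      g.1 ⟨param a b K v, v.2⟩ := fun g v => by
    rw [pullback_apply]
    exact congrArg g.1 (Subtype.ext (paramCoord_apply a b K V hV v))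
  have hcomp : G.comp (pullback (paramCoord a b K V hV) hΘ) =
      Ideal.Quotient.mkₐ ℂ (relationIdeal a b) :=
    algHom_ext_polyHom (U := phaseSpace b) (S := regularFunctions (phaseSpace b) ⧸
      relationIdeal a b) fun s => by rw [AlgHom.comp_apply, pullback_polyHom_X, hG]
  refine ideal_eq_and_smooth_of_factorization H hH (relationIdeal_le hk ha)
    (pullback (paramCoord a b K V hV) hΘ) (fun g => ⟨fun h x hx => ?_, fun h => ?_⟩)
    (fun s => ?_) G (fun g => DFunLike.congr_fun hcomp g)
  · obtain ⟨v, hvx⟩ := exists_param_eq (K := K) ha hKl x.1 hx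
    have hv : param a b K v ∈ phaseSpace b := hvx ▸ x.2
    have h1 := hval g ⟨v, hv⟩
    rw [h] at h1
    have h2 : (⟨param a b K v, hv⟩ : phaseSpace b) = x := Subtype.ext hvx
    rw [← h2]
    exact h1.symm
  · refine Subtype.ext (funext fun v => ?_)
    rw [hval]
    exact h _ (param_mem_lagrangianSet ha hbK v.1 v.2)
  · obtain ⟨q, hq⟩ := exists_regular_inverse (a := a) hc hlK s
    refine ⟨q, Subtype.ext (funext fun v => ?_)⟩
    rw [hval, hq, polyHom_apply, eval_X]

end Ideal

/-! The tangent spaces of the Lagrangian set -/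

section Tangent

variable {n k : ℕ} {a : Fin n → ℂ} {b : Matrix (Fin n) (Fin k) ℂ}

/-- The derivative of polynomials at the point `x` in the direction `v`. -/
def dirDeriv {σ : Type} [Fintype σ] (x v : σ → ℂ) : MvPolynomial σ ℂ →ₗ[ℂ] ℂ :=
  ∑ s, v s • ((aeval x).toLinearMap ∘ₗ (pderiv (R := ℂ) s).toLinearMap)

theorem dirDeriv_apply {σ : Type} [Fintype σ] (x v : σ → ℂ) (P : MvPolynomial σ ℂ) :
    dirDeriv x v P = ∑ s, eval x (pderiv s P) * v s := by
  simp only [dirDeriv, LinearMap.sum_apply, LinearMap.smul_apply, LinearMap.comp_apply, smul_eq_mul]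
  exact Finset.sum_congr rfl fun s _ => mul_comm _ _

theorem dirDeriv_mul {σ : Type} [Fintype σ] (x v : σ → ℂ) (P Q : MvPolynomial σ ℂ) :
    dirDeriv x v (P * Q) = eval x P * dirDeriv x v Q + eval x Q * dirDeriv x v P := by
  simp only [dirDeriv_apply, Finset.mul_sum, ← Finset.sum_add_distrib]
  refine Finset.sum_congr rfl fun s _ => ?_
  rw [Derivation.leibniz, map_add, smul_eq_mul, smul_eq_mul, map_mul, map_mul]
  ring

theorem dirDeriv_X {σ : Type} [Fintype σ] (x v : σ → ℂ) (s : σ) :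
    dirDeriv x v (X s) = v s := by
  classical
  rw [dirDeriv_apply, Finset.sum_eq_single s]
  · simp
  · intro r _ hr
    rw [pderiv_X_of_ne hr.symm, map_zero, zero_mul]
  · simp

theorem dirDeriv_C {σ : Type} [Fintype σ] (x v : σ → ℂ) (c : ℂ) :
    dirDeriv x v (C c) = 0 := by
  rw [dirDeriv_apply]
  simp

theorem hasDerivAt_eval {σ : Type} [Fintype σ] {γ : ℂ → σ → ℂ} {v : σ → ℂ} {e : ℂ}
    (hγ : ∀ s, HasDerivAt (fun r => γ r s) (v s) e) (P : MvPolynomial σ ℂ) :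
    HasDerivAt (fun r => eval (γ r) P) (dirDeriv (γ e) v P) e := by
  induction P using MvPolynomial.induction_on with
  | C c => simpa [dirDeriv_C] using hasDerivAt_const e c
  | add p q hp hq =>
    simp only [map_add]
    exact hp.fun_add hq
  | mul_X p i hp =>
    rw [dirDeriv_mul, dirDeriv_X, eval_X, mul_comm (γ e i), add_comm]
    simp only [map_mul, eval_X]
    exact hp.fun_mul (hγ i)

/-- The right side is the image of the derivative of `(p, t) ↦ (a / p - b t, p)`. One inclusion
differentiates the equations of `Λ`; the other realizes each such vector as the velocity of a curve
in `Λ`. -/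
theorem mem_tangentSpaceAt_iff (hkn : k < n) (hb : IsGeneric b) (ha : ∀ j, a j ≠ 0)
    {x : Fin n ⊕ Fin n → ℂ} (hx : x ∈ lagrangianSet a b) (v : Fin n ⊕ Fin n → ℂ) :
    v ∈ tangentSpaceAt (lagrangianSet a b) x ↔ (∀ m, ∑ j, b j m * v (Sum.inr j) = 0) ∧
      ∃ t : Fin k → ℂ, ∀ j, v (Sum.inl j) =
        -(a j * v (Sum.inr j) / x (Sum.inr j) ^ 2) - ∑ m, b j m * t m := by
  obtain ⟨hxU, hker, t, ht⟩ := (mem_lagrangianSet_iff a ha b x).1 hx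
  obtain ⟨c, hc⟩ := exists_left_inverse hkn b hb
  have hp := hxU.2
  constructor
  · intro hv
    have hv' : ∀ P : MvPolynomial (Fin n ⊕ Fin n) ℂ, (∀ y ∈ lagrangianSet a b, eval y P = 0) →
        dirDeriv x v P = 0 := fun P hP => by
      rw [dirDeriv_apply]
      exact hv P hP
    constructor
    · intro m
      have h := hv' (∑ j, b j m • X (Sum.inr j)) fun y hy => by
        simpa [smul_eval] using ((mem_lagrangianSet_iff a ha b y).1 hy).2.1 m
      simpa [dirDeriv_X] using h
    · have key : ∀ u, Matrix.vecMul u b = 0 →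
          ∑ j, u j * -(v (Sum.inl j) + a j * v (Sum.inr j) / x (Sum.inr j) ^ 2) = 0 := fun u hu => by
        -- `E` is the product of all `p_j` and `E' j` is `E / p_j`: multiplying by `E` turns `∑ u_j
        -- (z_j - a_j / p_j)` into a polynomial vanishing on `Λ`.
        set E : MvPolynomial (Fin n ⊕ Fin n) ℂ := ∏ j, X (Sum.inr j) with hE
        let E' : Fin n → MvPolynomial (Fin n ⊕ Fin n) ℂ := fun j =>
          ∏ i ∈ Finset.univ.erase j, X (Sum.inr i)
        have hE' : ∀ j, X (Sum.inr j) * E' j = E := fun j =>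
          Finset.mul_prod_erase _ _ (Finset.mem_univ j)
        have hEx : ∀ y ∈ lagrangianSet a b, ∀ j, eval y (E' j) = eval y E / y (Sum.inr j) :=
          fun y hy j => by
            have hyp := ((mem_lagrangianSet_iff a ha b y).1 hy).1.2 j
            rw [← hE' j, map_mul, eval_X, mul_div_cancel_left₀ _ hyp]
        have hsum : ∀ y ∈ lagrangianSet a b,
            ∑ j, u j * (y (Sum.inl j) - a j / y (Sum.inr j)) = 0 := fun y hy => by
          obtain ⟨-, -, r, hr⟩ := (mem_lagrangianSet_iff a ha b y).1 hy
          have h1 : ∀ j, u j * (y (Sum.inl j) - a j / y (Sum.inr j)) =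
              -(u j * ∑ m, b j m * r m) := fun j => by
            rw [hr]
            ring
          simp only [h1, Finset.sum_neg_distrib, sum_mul_sum_eq_zero u hu, neg_zero]
        have h := hv' (∑ j, u j • (X (Sum.inl j) * E - a j • E' j)) fun y hy => by
          rw [← mul_zero (eval y E), ← hsum y hy, map_sum, Finset.mul_sum]
          refine Finset.sum_congr rfl fun j _ => ?_
          rw [smul_eval, map_sub, map_mul, smul_eval, eval_X, hEx y hy]
          ring
        have hD : ∀ j, dirDeriv x v (E' j) =
            dirDeriv x v E / x (Sum.inr j) - v (Sum.inr j) * eval x E / x (Sum.inr j) ^ 2 :=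
          fun j => by
            have h1 := dirDeriv_mul x v (X (Sum.inr j)) (E' j)
            rw [hE', eval_X, dirDeriv_X, hEx x hx] at h1
            have := hp j
            rw [h1]
            field_simp
            ring
        have hE0 : eval x E ≠ 0 := by
          rw [hE, map_prod]
          exact Finset.prod_ne_zero_iff.2 fun j _ => by rw [eval_X]; exact hp j
        -- Product rule: the derivative of `E` multiplies a sum that vanishes at `x`, so only `E`
        -- times the derivative of the sum remains.
        have h2 : dirDeriv x v (∑ j, u j • (X (Sum.inl j) * E - a j • E' j)) =
            dirDeriv x v E * ∑ j, u j * (x (Sum.inl j) - a j / x (Sum.inr j)) -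
            eval x E *
              ∑ j, u j * -(v (Sum.inl j) + a j * v (Sum.inr j) / x (Sum.inr j) ^ 2) := by
          rw [map_sum, Finset.mul_sum, Finset.mul_sum, ← Finset.sum_sub_distrib]
          refine Finset.sum_congr rfl fun j _ => ?_
          rw [map_smul, map_sub, map_smul, dirDeriv_mul, dirDeriv_X, eval_X, hD, smul_eq_mul,
            smul_eq_mul]
          ring
        rw [h2, hsum x hx, mul_zero, zero_sub, neg_eq_zero] at h
        exact (mul_eq_zero.1 h).resolve_left hE0
      obtain ⟨τ, hτ⟩ := exists_eq_sum_mul hc _ key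
      exact ⟨τ, fun j => by rw [← hτ j]; ring⟩
  · rintro ⟨hv, τ, hτ⟩ P hP
    rw [← dirDeriv_apply]
    -- Both `p` and `t` move along straight lines. The curve stays in `Λ` as long as it stays in the
    -- open phase space, hence for small `r`.
    let γ : ℂ → Fin n ⊕ Fin n → ℂ := fun r => Sum.elim
      (fun j => a j / (x (Sum.inr j) + r * v (Sum.inr j)) - ∑ m, b j m * (t m + r * τ m))
      (fun j => x (Sum.inr j) + r * v (Sum.inr j))
    have hγ0 : γ 0 = x := by
      funext s
      rcases s with j | j
      · simp [γ, ht j]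
      · simp [γ]
    have hγ : ∀ s, HasDerivAt (fun r => γ r s) (v s) 0 := by
      have hlin : ∀ y w : ℂ, HasDerivAt (fun r : ℂ => y + r * w) w 0 := fun y w => by
        simpa using ((hasDerivAt_id (0 : ℂ)).mul_const w).const_add y
      rintro (j | j)
      · have h1 := ((hasDerivAt_const (0 : ℂ) (a j)).div (hlin (x (Sum.inr j)) (v (Sum.inr j)))
          (by simpa using hp j)).fun_sub
          (HasDerivAt.fun_sum fun m (_ : m ∈ Finset.univ) => (hlin (t m) (τ m)).const_mul (b j m))
        rw [hτ j]
        refine h1.congr_deriv ?_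
        simp [neg_div]
      · exact hlin _ _
    obtain ⟨H, hH⟩ := exists_phaseSpace_eq b
    have hmem : ∀ᶠ r in nhds (0 : ℂ), γ r ∈ lagrangianSet a b := by
      have h1 : ∀ᶠ r in nhds (0 : ℂ), eval (γ r) H ≠ 0 :=
        (hasDerivAt_eval hγ H).continuousAt.eventually_ne (by rw [hγ0]; exact (hH x).1 hxU)
      filter_upwards [h1] with r hr
      refine (mem_lagrangianSet_iff a ha b _).2
        ⟨(hH _).2 hr, fun m => ?_, fun m => t m + r * τ m, fun j => rfl⟩
      have h2 : ∀ j, b j m * γ r (Sum.inr j) =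
          b j m * x (Sum.inr j) + r * (b j m * v (Sum.inr j)) := fun j => by
        simp only [γ, Sum.elim_inr]
        ring
      simp only [h2, Finset.sum_add_distrib, ← Finset.mul_sum, hker, hv, mul_zero, add_zero]
    have h3 := hasDerivAt_eval hγ P
    rw [hγ0] at h3
    refine h3.unique ((hasDerivAt_const (0 : ℂ) (0 : ℂ)).congr_of_eventuallyEq ?_)
    filter_upwards [hmem] with r hr using hP _ hr

/-- `L` is the derivative of the parametrization; the left inverses `l` and `c` make it injective on
a space of dimension `(n - k) + k`. -/
theorem finrank_tangentSpaceAt (hkn : k < n) (hb : IsGeneric b) (ha : ∀ j, a j ≠ 0)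
    {x : Fin n ⊕ Fin n → ℂ} (hx : x ∈ lagrangianSet a b) :
    Module.finrank ℂ (tangentSpaceAt (lagrangianSet a b) x) = n := by
  obtain ⟨c, hc⟩ := exists_left_inverse hkn b hb
  obtain ⟨K, l, hbK, hlK, hKl⟩ := exists_kernel_matrix b c hc
  let L : (Fin (n - k) → ℂ) × (Fin k → ℂ) →ₗ[ℂ] (Fin n ⊕ Fin n → ℂ) :=
    { toFun := fun q => Sum.elim
        (fun j => -(a j * Matrix.mulVec K q.1 j / x (Sum.inr j) ^ 2) - Matrix.mulVec b q.2 j)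
        (Matrix.mulVec K q.1)
      map_add' := fun q r => by
        funext s
        rcases s with j | j
        · simp only [Prod.fst_add, Prod.snd_add, Matrix.mulVec_add, Pi.add_apply, Sum.elim_inl]
          ring
        · simp only [Prod.fst_add, Matrix.mulVec_add, Pi.add_apply, Sum.elim_inr]
      map_smul' := fun r q => by
        funext s
        rcases s with j | j
        · simp only [Prod.smul_fst, Prod.smul_snd, Matrix.mulVec_smul, Pi.smul_apply,
            Sum.elim_inl, smul_eq_mul, RingHom.id_apply]
          ring
        · simp only [Prod.smul_fst, Matrix.mulVec_smul, Pi.smul_apply, Sum.elim_inr,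
            RingHom.id_apply] }
  have hL : Function.Injective L := by
    rw [← LinearMap.ker_eq_bot, LinearMap.ker_eq_bot']
    rintro ⟨s, t⟩ h
    have h1 : Matrix.mulVec K s = 0 := funext fun j => congrFun h (Sum.inr j)
    have h2 : Matrix.mulVec b t = 0 := funext fun j => by
      have := congrFun h (Sum.inl j)
      change -(a j * Matrix.mulVec K s j / x (Sum.inr j) ^ 2) - Matrix.mulVec b t j = 0 at this
      simpa [h1] using this
    have h3 : s = 0 := by
      rw [← Matrix.one_mulVec s, ← hlK, ← Matrix.mulVec_mulVec, h1, Matrix.mulVec_zero]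
    have h4 : t = 0 := by
      rw [← Matrix.one_mulVec t, ← hc, ← Matrix.mulVec_mulVec, h2, Matrix.mulVec_zero]
    rw [h3, h4]
    rfl
  have hrange : tangentSpaceAt (lagrangianSet a b) x = LinearMap.range L := by
    ext v
    rw [mem_tangentSpaceAt_iff hkn hb ha hx, LinearMap.mem_range]
    constructor
    · rintro ⟨hv, t, ht⟩
      have h1 : Matrix.mulVec K (Matrix.mulVec l (fun j => v (Sum.inr j))) =
          fun j => v (Sum.inr j) := mulVec_mulVec_of_mem_ker hKl _ hv
      refine ⟨(Matrix.mulVec l (fun j => v (Sum.inr j)), t), funext fun s => ?_⟩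
      rcases s with j | j
      · change -(a j * Matrix.mulVec K (Matrix.mulVec l (fun j => v (Sum.inr j))) j /
          x (Sum.inr j) ^ 2) - Matrix.mulVec b t j = _
        rw [h1, ht]
        rfl
      · exact congrFun h1 j
    · rintro ⟨⟨s, t⟩, rfl⟩
      refine ⟨fun m => ?_, t, fun j => rfl⟩
      have h1 : Matrix.mulVec b.transpose (Matrix.mulVec K s) = 0 := by
        rw [Matrix.mulVec_mulVec, hbK, Matrix.zero_mulVec]
      exact congrFun h1 m
  rw [hrange, LinearMap.finrank_range_of_inj hL, Module.finrank_prod, Module.finrank_fin_fun,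
    Module.finrank_fin_fun]
  omega

/-- The terms `a_j v_j w_j / p_j ^ 2` are symmetric in the two vectors and cancel; the rest pairs
the kernel of `bᵀ` with the image of `b`. -/
theorem isotropic_tangentSpaceAt (hkn : k < n) (hb : IsGeneric b) (ha : ∀ j, a j ≠ 0)
    {x : Fin n ⊕ Fin n → ℂ} (hx : x ∈ lagrangianSet a b) (v w : Fin n ⊕ Fin n → ℂ)
    (hv : v ∈ tangentSpaceAt (lagrangianSet a b) x)
    (hw : w ∈ tangentSpaceAt (lagrangianSet a b) x) : symplecticForm v w = 0 := by
  obtain ⟨hv1, t, ht⟩ := (mem_tangentSpaceAt_iff hkn hb ha hx v).1 hv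
  obtain ⟨hw1, r, hr⟩ := (mem_tangentSpaceAt_iff hkn hb ha hx w).1 hw
  have hker : ∀ {u : Fin n ⊕ Fin n → ℂ}, (∀ m, ∑ j, b j m * u (Sum.inr j) = 0) →
      Matrix.vecMul (fun j => u (Sum.inr j)) b = 0 := fun {u} hu => funext fun m => by
    simpa only [Matrix.vecMul, dotProduct, mul_comm, Pi.zero_apply] using hu m
  have h : ∀ j, v (Sum.inr j) * w (Sum.inl j) - v (Sum.inl j) * w (Sum.inr j) =
      w (Sum.inr j) * ∑ m, b j m * t m - v (Sum.inr j) * ∑ m, b j m * r m := fun j => by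
    rw [ht, hr]
    ring
  rw [symplecticForm]
  simp only [h]
  rw [Finset.sum_sub_distrib, sum_mul_sum_eq_zero (fun j => w (Sum.inr j)) (hker hw1),
    sum_mul_sum_eq_zero (fun j => v (Sum.inr j)) (hker hv1), sub_zero]

end Tangent

end MasterLagrangian

end

theorem theorem3p3 (n k : ℕ) (hk : 0 < k) (hkn : k < n)
    (b : Matrix (Fin n) (Fin k) ℂ) (hb : MasterLagrangian.IsGeneric b)
    (a : Fin n → ℂ) (ha : ∀ j, a j ≠ 0) (hsum : ∑ j, a j ≠ 0) :
    MasterLagrangian.vanishingIdealOn (MasterLagrangian.phaseSpace b)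
        (MasterLagrangian.lagrangianSet a b) = MasterLagrangian.relationIdeal a b ∧
      MasterLagrangian.IsSmoothLagrangianIn (MasterLagrangian.phaseSpace b)
        (MasterLagrangian.lagrangianSet a b) := by
  obtain ⟨heq, hsmooth⟩ := MasterLagrangian.vanishingIdealOn_eq_and_smooth hk hkn hb ha
  exact ⟨heq,
    { nonempty := MasterLagrangian.lagrangianSet_nonempty hkn b hb a ha hsum
      closed := MasterLagrangian.isZariskiClosedIn_lagrangianSet hk hkn hb ha
      smooth := hsmooth
      finrank_tangent := fun _ hx => MasterLagrangian.finrank_tangentSpaceAt hkn hb ha hx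
      isotropic := fun _ hx v hv w hw =>
        MasterLagrangian.isotropic_tangentSpaceAt hkn hb ha hx v w hv hw }⟩
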